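/- For $\tau$ in the upper half-plane $\mathbb H$ put $q=e^{2\pi i\tau}$, $q^{1/2}=e^{\pi i\tau}$ and $\eta_d=\eta(d\tau)$, where $\eta(\tau)=q^{1/24}\prod_{m\ge1}(1-q^m)$ (with $q^{1/24}=e^{2\pi i\tau/24}$) is the Dedekind eta function, and let $$z=\frac{4\eta_1^4\eta_4^8}{\eta_2^{12}},\qquad \tilde z=\sqrt{1-z^2}=\frac{\eta_1^8\eta_4^4}{\eta_2^{12}},\qquad F={}_2F_1\bigl(\tfrac12,\tfrac12;1;z^2\bigr)=\frac{\eta_2^{10}}{\eta_1^4\eta_4^4},$$ the eta quotients being the definition on all of $\mathbb H$ (they fix the branches of the square root and of the hypergeometric function). For integers $k\ge1$ let $$\mathrm{Eis}_k(\tau)=q^{1/2}\sum_{\substack{n\ge1\\ n\text{ odd}}}\frac{n^{k-1}\bigl((-1)^{k-1}q\bigr)^{(n-1)/2}}{1+q^n},\qquad \widetilde{\mathrm{Eis}}_k(\tau)=\sum_{n\ge1}\frac{n^{k-1}(-q)^n}{1+q^{2n}}.$$ For $k>1$ define the function $\mu_k$, and for odd $k>1$ the function $\nu_k$, on the set $\{z(\tau)^2:\tau\in\mathbb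 H\}\subset\mathbb C$ by requiring, for all $\tau\in\mathbb H$, $$\mathrm{Eis}_k=\tfrac14F^k z\tilde z\,\mu_k(z^2)\ (k\text{ even}),\qquad \mathrm{Eis}_k=\tfrac14F^k z\,\mu_k(z^2)\ (k\text{ odd}),\qquad \widetilde{\mathrm{Eis}}_k=\tfrac14F^k\tilde z\,\nu_k(z^2)\ (k\text{ odd}).$$ **Corollary.** Let $k>1$ be an integer. The function $\mu_k$ is well defined and is given by a polynomial $\mu_k(x)\in\mathbb Z[x]$ of degree at most $k$. If $k$ is also odd, then the function $\nu_k$ is well defined and is given by a polynomial $\nu_k(x)\in\mathbb Q[x]$ of degree at most $k$ with $\nu_k(0)=0$. -/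

import Mathlib

noncomputable section

namespace EisPoly

open UpperHalfPlane

/-- `etaAt d τ = η(d τ)`, with `η` the Dedekind eta function. -/
def etaAt (d : ℕ) (τ : ℍ) : ℂ := ModularForm.eta ((d : ℂ) * (τ : ℂ))

/-- The nome `q = exp (2 π i τ)`. -/
def q (τ : ℍ) : ℂ := Complex.exp (2 * Real.pi * Complex.I * (τ : ℂ))

/-- The square root `q ^ (1/2) = exp (π i τ)`. -/
def qHalf (τ : ℍ) : ℂ := Complex.exp (Real.pi * Complex.I * (τ : ℂ))

/-- The modular function `z = 4 η(τ)^4 η(4τ)^8 / η(2τ)^12`. -/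
def z (τ : ℍ) : ℂ := 4 * etaAt 1 τ ^ 4 * etaAt 4 τ ^ 8 / etaAt 2 τ ^ 12

/-- The modular function `z̃ = η(τ)^8 η(4τ)^4 / η(2τ)^12`; this is the branch of `√(1 - z ^ 2)` on
the upper half-plane which tends to `1` at `i∞`. -/
def zTilde (τ : ℍ) : ℂ := etaAt 1 τ ^ 8 * etaAt 4 τ ^ 4 / etaAt 2 τ ^ 12

/-- The weight one modular form `F = η(2τ)^10 / (η(τ)^4 η(4τ)^4)`; it is the continuation of
`₂F₁(1/2, 1/2; 1; z ^ 2)` from a neighbourhood of `i∞` to the upper half-plane. -/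
def F (τ : ℍ) : ℂ := etaAt 2 τ ^ 10 / (etaAt 1 τ ^ 4 * etaAt 4 τ ^ 4)

/-- `Eis_k = q^(1/2) ∑_{n ≥ 1, n odd} n^(k-1) ((-1)^(k-1) q)^((n-1)/2) / (1 + q^n)` for `k ≥ 1`;
the odd index is written as `n = 2 m + 1`. -/
def Eis (k : ℕ) (τ : ℍ) : ℂ :=
  qHalf τ * ∑' m : ℕ,
    ((2 * m + 1 : ℕ) : ℂ) ^ (k - 1) * ((-1) ^ (k - 1) * q τ) ^ m / (1 + q τ ^ (2 * m + 1))

/-- `Ẽis_k = ∑_{n ≥ 1} n^(k-1) (-q)^n / (1 + q^(2n))` for `k ≥ 1`. -/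
def EisTilde (k : ℕ) (τ : ℍ) : ℂ :=
  ∑' n : ℕ+, ((n : ℕ) : ℂ) ^ (k - 1) * (-q τ) ^ (n : ℕ) / (1 + q τ ^ (2 * (n : ℕ)))

/-- The set of values of `z ^ 2` on the upper half-plane: the arguments `x` at which `μ_k(x)` and
`ν_k(x)` are defined by the relations below. -/
def zSqValues : Set ℂ := Set.range fun τ : ℍ => z τ ^ 2

/-- The relation that defines the function `μ_k` (on `zSqValues`):
`Eis_k = 1/4 F^k z z̃ μ_k(z^2)` for even `k`, and `Eis_k = 1/4 F^k z μ_k(z^2)` for odd `k`. -/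
def IsMu (k : ℕ) (μ : ℂ → ℂ) : Prop :=
  (Even k → ∀ τ : ℍ, Eis k τ = 1 / 4 * F τ ^ k * z τ * zTilde τ * μ (z τ ^ 2)) ∧
  (Odd k → ∀ τ : ℍ, Eis k τ = 1 / 4 * F τ ^ k * z τ * μ (z τ ^ 2))

/-- The relation that defines the function `ν_k` (on `zSqValues`) for odd `k > 1`:
`Ẽis_k = 1/4 F^k z̃ ν_k(z^2)`. -/
def IsNu (k : ℕ) (ν : ℂ → ℂ) : Prop :=
  ∀ τ : ℍ, EisTilde k τ = 1 / 4 * F τ ^ k * zTilde τ * ν (z τ ^ 2)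

end EisPoly

end

noncomputable section

namespace EisPoly

open UpperHalfPlane Finset Filter Topology

/-! The Eisenstein series are, up to elementary constants, derivatives of Jacobi elliptic functions
at 0 and at a quarter period. With nome `x = qHalf τ`, let s, c, d be the rescaled functions F·k·sn,
F·k·cn, F·dn, defined by their Fourier series with coefficients x^m / (1 ∓ x^(2m)). They satisfy s'
= cd, c' = -sd, d' = -sc. Hence an even derivative of c (or d) is c (or d) times an integral
homogeneous polynomial in s², c², d², and an odd derivative of c is sd times such a polynomial.
Since (s, c, d) is (0, Fz, F) at t = 0 and (Fz, 0, Fz̃) at t = π/2, homogeneity extracts the power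
of F and leaves a polynomial in z².

The differential system is proved on Fourier coefficients (`lamSeries_mul`): in a product of two
series each convolution has a common Lambert factor times a sum of two kinks (`tsum_kinks`), which
is linear in the frequency and so acts as d/dt. The special values are bilateral sums, computed as
infinite products by a case of Ramanujan's ₁ψ₁ formula (`bilateral_sum`), itself a limit of a
partial fraction expansion. Comparison with eta quotients gives F, Fz, Fz̃, and the first integral
d² - c² gives z̃² = 1 - z². Finally F, z, z̃ have no zeros, so the defining relations determine μ
and ν on the values of z². -/

/-! ### Partial fractions and a terminating bilateral sum -/

lemma one_sub_pow_ne_zero {y : ℂ} (hy : ‖y‖ < 1) {n : ℕ} (hn : n ≠ 0) : 1 - y ^ n ≠ 0 := by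
  intro h
  have h1 : ‖y ^ n‖ = 1 := by rw [← sub_eq_zero.mp h, norm_one]
  rw [norm_pow] at h1
  exact absurd h1 (pow_lt_one₀ (norm_nonneg _) hy hn).ne

lemma one_add_pow_ne_zero {y : ℂ} (hy : ‖y‖ < 1) {n : ℕ} (hn : n ≠ 0) : 1 + y ^ n ≠ 0 := by
  intro h
  have h1 : ‖y ^ n‖ = 1 := by rw [eq_neg_of_add_eq_zero_right h, norm_neg, norm_one]
  rw [norm_pow] at h1
  exact absurd h1 (pow_lt_one₀ (norm_nonneg _) hy hn).ne

/-- Partial fraction expansion of `f / ∏ (1 - c i X)`. -/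
lemma partial_fraction {K : Type*} [Field K] {ι : Type*} [DecidableEq ι] (s : Finset ι) (c : ι → K)
    (hc : ∀ i ∈ s, c i ≠ 0) (hinj : Set.InjOn c s) (f : Polynomial K) (hf : f.degree < #s) (b : K)
    (hb : ∀ i ∈ s, 1 - b * c i ≠ 0) :
    f.eval b / ∏ i ∈ s, (1 - b * c i) =
      ∑ i ∈ s, f.eval (c i)⁻¹ / (∏ k ∈ s.erase i, (1 - c k / c i)) / (1 - b * c i) := by
  have hinj' : Set.InjOn (fun i => (c i)⁻¹) s := fun i hi j hj h => hinj hi hj (inv_injective h)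
  have hne : ∀ i ∈ s, b ≠ (c i)⁻¹ := by
    intro i hi h
    apply hb i hi
    rw [h, inv_mul_cancel₀ (hc i hi), sub_self]
  -- By the degree bound, `f` equals its Lagrange interpolant at the poles 1 / c i; the barycentric
  -- form of the interpolant is the expansion.
  have key := Lagrange.eval_interpolate_not_at_node (fun i => f.eval (c i)⁻¹) hne
  rw [← Lagrange.eq_interpolate hinj' hf, Lagrange.eval_nodal] at key
  have h1 : ∏ i ∈ s, (b - (c i)⁻¹) = (∏ i ∈ s, (1 - b * c i)) * ∏ i ∈ s, (-(c i)⁻¹) := by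
    rw [← Finset.prod_mul_distrib]
    refine Finset.prod_congr rfl fun i hi => ?_
    have := hc i hi
    field_simp
    ring
  have hP : ∏ i ∈ s, (1 - b * c i) ≠ 0 := Finset.prod_ne_zero_iff.mpr hb
  rw [key, h1, div_eq_iff hP, mul_comm _ (∏ i ∈ s, (1 - b * c i)), mul_assoc]
  congr 1
  rw [Finset.mul_sum]
  refine Finset.sum_congr rfl fun i hi => ?_
  have hci := hc i hi
  have h2 : ∏ k ∈ s.erase i, (1 - c k / c i) =
      (∏ k ∈ s.erase i, ((c i)⁻¹ - (c k)⁻¹)) * (∏ k ∈ s.erase i, (-c k)) := by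
    rw [← Finset.prod_mul_distrib]
    refine Finset.prod_congr rfl fun k hk => ?_
    have := hc k (Finset.mem_of_mem_erase hk)
    field_simp
    ring
  have h3 : ∏ k ∈ s, (-(c k)⁻¹) = -(c i)⁻¹ * (∏ k ∈ s.erase i, (-c k))⁻¹ := by
    rw [← Finset.mul_prod_erase s _ hi, ← Finset.prod_inv_distrib]
    congr 1
    exact Finset.prod_congr rfl fun k hk => by rw [inv_neg]
  have h4 : ∏ k ∈ s.erase i, ((c i)⁻¹ - (c k)⁻¹) ≠ 0 := by
    refine Finset.prod_ne_zero_iff.mpr fun k hk h => ?_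
    exact Finset.ne_of_mem_erase hk (hinj' (Finset.mem_of_mem_erase hk) hi
      (sub_eq_zero.mp h).symm)
  have h5 : ∏ k ∈ s.erase i, (-c k) ≠ 0 :=
    Finset.prod_ne_zero_iff.mpr fun k hk => neg_ne_zero.mpr (hc k (Finset.mem_of_mem_erase hk))
  have h6 : b - (c i)⁻¹ ≠ 0 := sub_ne_zero.mpr (hne i hi)
  have h7 : 1 - b * c i = (b - (c i)⁻¹) * (-c i) := by field_simp; ring
  rw [h2, h3, Lagrange.nodalWeight, Finset.prod_inv_distrib, h7]
  field_simp

/-- The partial products `∏ (1 - y^(2i+1)) / (1 - y^(2i+2))`. -/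
def ratioProd (y : ℂ) (n : ℕ) : ℂ := ∏ i ∈ range n, (1 - y ^ (2 * i + 1)) / (1 - y ^ (2 * i + 2))

lemma pow_two_injective {y : ℂ} (hy0 : y ≠ 0) (hy : ‖y‖ < 1) :
    Function.Injective fun i : ℕ => y ^ (2 * i) := by
  intro i j h
  have h1 : ‖y‖ ^ (2 * i) = ‖y‖ ^ (2 * j) := by
    simpa using congrArg norm h
  have := pow_right_injective₀ (norm_pos_iff.mpr hy0) hy.ne h1
  omega

/-- A terminating form of the bilateral sum `∑ y^n / (1 - b y^(2n))`. -/
lemma sum_ratioProd {y : ℂ} (hy0 : y ≠ 0) (hy : ‖y‖ < 1) (K : ℕ) (b : ℂ)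
    (hb : ∀ i ∈ range (K + 1), 1 - b * y ^ (2 * i) ≠ 0) :
    ∑ n ∈ range (K + 1), y ^ n * ratioProd y n * ratioProd y (K - n) / (1 - b * y ^ (2 * n)) =
      (∏ i ∈ range K, (1 - b * y ^ (2 * i + 1))) / ∏ i ∈ range (K + 1), (1 - b * y ^ (2 * i)) := by
  classical
  set f : Polynomial ℂ := ∏ i ∈ range K, (1 - Polynomial.X * Polynomial.C (y ^ (2 * i + 1))) with hf
  have hfe : ∀ x, f.eval x = ∏ i ∈ range K, (1 - x * y ^ (2 * i + 1)) := by
    intro x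
    simp [hf, Polynomial.eval_prod]
  have hdeg : f.degree < #(range (K + 1)) := by
    have : f.natDegree ≤ ∑ i ∈ range K, 1 := by
      refine (Polynomial.natDegree_prod_le _ _).trans (Finset.sum_le_sum fun i _ => ?_)
      compute_degree
    rw [card_range]
    refine lt_of_le_of_lt Polynomial.degree_le_natDegree ?_
    simp at this
    exact_mod_cast Nat.lt_succ_of_le this
  have h := partial_fraction (range (K + 1)) (fun i => y ^ (2 * i)) (fun i _ => pow_ne_zero _ hy0)
    (pow_two_injective hy0 hy).injOn f hdeg b hb
  rw [hfe] at h
  rw [h]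
  refine Finset.sum_congr rfl fun n hn => ?_
  congr 1
  have hnK : n ≤ K := by simpa [Nat.lt_succ_iff] using hn
  obtain ⟨m, rfl⟩ := Nat.exists_eq_add_of_le hnK
  have e1 : (range (n + m + 1)).erase n = range n ∪ (Finset.range m).image (fun i => n + 1 + i) := by
    ext i
    simp only [mem_erase, mem_range, mem_union, mem_image]
    constructor
    · rintro ⟨h1, h2⟩
      rcases lt_or_gt_of_ne h1 with h | h
      · exact Or.inl h
      · exact Or.inr ⟨i - (n + 1), by omega, by omega⟩
    · rintro (h | ⟨j, hj, rfl⟩) <;> omega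
  have e2 : Disjoint (range n) ((Finset.range m).image (fun i => n + 1 + i)) := by
    rw [Finset.disjoint_left]
    intro i hi hi'
    simp only [mem_range, mem_image] at hi hi'
    omega
  rw [hfe, Finset.prod_range_add, e1, Finset.prod_union e2,
    Finset.prod_image (fun a _ b _ h => by simpa using h), mul_div_mul_comm, ← Finset.prod_div_distrib,
    ← Finset.prod_div_distrib, Nat.add_sub_cancel_left]
  congr 1
  -- For indices below n the exponents are negative; clearing them leaves one factor y per index,
  -- whence y^n.
  · rw [ratioProd, ← Finset.prod_range_reflect (fun i => (1 - y ^ (2 * i + 1)) / (1 - y ^ (2 * i + 2)))]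
    conv_lhs => rw [← Finset.card_range n, ← Finset.prod_const, Finset.card_range]
    rw [← Finset.prod_mul_distrib]
    refine Finset.prod_congr rfl fun i hi => ?_
    rw [mem_range] at hi
    obtain ⟨l, rfl⟩ := Nat.exists_eq_add_of_lt hi
    have e : i + l + 1 - 1 - i = l := by omega
    rw [e]
    have h1 : 1 - y ^ (2 * l + 2) ≠ 0 := one_sub_pow_ne_zero hy (by omega)
    have h2 : y ^ (2 * (i + l + 1)) - y ^ (2 * i) ≠ 0 := by
      rw [show y ^ (2 * (i + l + 1)) - y ^ (2 * i) = -(y ^ (2 * i) * (1 - y ^ (2 * l + 2))) by ring]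
      exact neg_ne_zero.mpr (mul_ne_zero (pow_ne_zero _ hy0) h1)
    have h3 : y ^ (2 * (i + l + 1)) ≠ 0 := pow_ne_zero _ hy0
    rw [show 1 - y ^ (2 * i) / y ^ (2 * (i + l + 1)) =
      (y ^ (2 * (i + l + 1)) - y ^ (2 * i)) / y ^ (2 * (i + l + 1)) by field_simp]
    rw [inv_mul_eq_div, one_sub_div h3, div_div_div_cancel_right₀ h3, mul_div_assoc', div_eq_div_iff h1 h2]
    ring
  · rw [ratioProd]
    refine Finset.prod_congr rfl fun i hi => ?_
    have h3 : y ^ (2 * n) ≠ 0 := pow_ne_zero _ hy0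
    congr 2
    · field_simp; ring
    · field_simp; ring

/-- Symmetric form of `sum_ratioProd`. -/
lemma sum_ratioProd_symm {y : ℂ} (hy0 : y ≠ 0) (hy : ‖y‖ < 1) (N : ℕ) (a : ℂ)
    (ha : ∀ j : ℤ, 1 - a * y ^ (2 * j) ≠ 0) :
    ∑ j ∈ Finset.Icc (-N : ℤ) N, y ^ j * ratioProd y (N + j).toNat * ratioProd y (N - j).toNat /
        (1 - a * y ^ (2 * j)) =
      (∏ i ∈ range N, (y ^ (2 * i + 1) - a) / (y ^ (2 * i + 2) - a)) *
      (∏ i ∈ range N, (1 - a * y ^ (2 * i + 1))) / ∏ i ∈ range (N + 1), (1 - a * y ^ (2 * i)) := by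
  have hz : ∀ i : ℕ, 1 - a * y ^ (-2 * N : ℤ) * y ^ (2 * i) = 1 - a * y ^ (2 * (i - N : ℤ)) := by
    intro i
    rw [mul_assoc, ← zpow_natCast, ← zpow_add₀ hy0]
    congr 3
    push_cast; ring
  -- Taking K = 2N and b = a y^(-2N) centres the summation range at 0.
  have h := sum_ratioProd hy0 hy (2 * N) (a * y ^ (-2 * N : ℤ)) (fun i _ => by rw [hz]; exact ha _)
  have hsum : ∑ j ∈ Finset.Icc (-N : ℤ) N, y ^ j * ratioProd y (N + j).toNat *
      ratioProd y (N - j).toNat / (1 - a * y ^ (2 * j)) = y ^ (-N : ℤ) *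
      ∑ n ∈ range (2 * N + 1), y ^ n * ratioProd y n * ratioProd y (2 * N - n) /
        (1 - a * y ^ (-2 * N : ℤ) * y ^ (2 * n)) := by
    rw [Finset.mul_sum]
    symm
    refine Finset.sum_bij (fun n _ => (n : ℤ) - N) ?_ ?_ ?_ ?_
    · intro n hn
      simp only [mem_range, Finset.mem_Icc] at hn ⊢
      omega
    · intro n _ m _ h
      omega
    · intro j hj
      simp only [mem_range, Finset.mem_Icc] at hj ⊢
      exact ⟨(j + N).toNat, by omega, by omega⟩
    · intro n hn
      simp only [mem_range] at hn
      rw [hz, show ((N : ℤ) + (n - N)).toNat = n by omega,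
        show ((N : ℤ) - (n - N)).toNat = 2 * N - n by omega, sub_eq_add_neg (n : ℤ), zpow_add₀ hy0,
        zpow_natCast]
      ring
  rw [hsum, h, two_mul N, Finset.prod_range_add, add_assoc N N 1, Finset.prod_range_add, mul_div_mul_comm,
    mul_div_assoc, ← mul_assoc]
  congr 1
  -- The first N factors involve negative powers of y; clearing them costs one y per index, which
  -- y^(-N) compensates.
  · rw [← Finset.prod_div_distrib, ← Finset.prod_range_reflect, zpow_neg, zpow_natCast]
    conv_lhs => rw [← Finset.card_range N, ← Finset.prod_const, Finset.card_range]
    rw [← Finset.prod_inv_distrib, ← Finset.prod_mul_distrib]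
    refine Finset.prod_congr rfl fun i hi => ?_
    rw [mem_range] at hi
    have hz2 := ha (-(i + 1 : ℕ))
    rw [hz]
    rw [show (2 * (((N - 1 - i : ℕ) : ℤ) - N)) = 2 * (-(i + 1 : ℕ)) by omega]
    have e1 : y ^ (-2 * N : ℤ) * y ^ (2 * (N - 1 - i) + 1) = (y ^ (2 * i + 1))⁻¹ := by
      rw [← zpow_natCast, ← zpow_natCast, ← zpow_neg, ← zpow_add₀ hy0]
      congr 1
      omega
    have e2 : y ^ (2 * (-(i + 1 : ℕ) : ℤ)) = (y ^ (2 * i + 2))⁻¹ := by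
      rw [← zpow_natCast, ← zpow_neg]
      congr 1
    rw [mul_assoc, e1]
    rw [e2] at hz2 ⊢
    have h3 : y ^ (2 * i + 1) ≠ 0 := pow_ne_zero _ hy0
    have h4 : y ^ (2 * i + 2) ≠ 0 := pow_ne_zero _ hy0
    have h5 : y ^ (2 * i + 2) - a ≠ 0 := by
      intro h
      apply hz2
      rw [← sub_eq_zero.mp h, mul_inv_cancel₀ h4, sub_self]
    rw [← div_eq_mul_inv a, ← div_eq_mul_inv a, one_sub_div h3, one_sub_div h4]
    field_simp
    ring
  · congr 1
    · refine Finset.prod_congr rfl fun i _ => ?_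
      rw [mul_assoc, ← zpow_natCast, ← zpow_natCast, ← zpow_add₀ hy0]
      congr 3
      push_cast; ring
    · refine Finset.prod_congr rfl fun i _ => ?_
      rw [hz, ← zpow_natCast]
      congr 3
      push_cast; ring

/-! ### Lambert coefficients and their decay -/

/-- The Lambert coefficients `x^m / (1 - σ x^(2m))`. -/
def lam (σ x : ℂ) (m : ℤ) : ℂ := x ^ m / (1 - σ * x ^ (2 * m))

/-- The factors `1 / (1 - σ x^(2m))`. -/
def fermi (σ x : ℂ) (m : ℤ) : ℂ := 1 / (1 - σ * x ^ (2 * m))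

lemma norm_eq_one_of_sq {σ : ℂ} (hσ : σ ^ 2 = 1) : ‖σ‖ = 1 := by
  rcases sq_eq_one_iff.mp hσ with h | h <;> simp [h]

lemma lam_neg {σ x : ℂ} (hσ : σ ^ 2 = 1) (hx0 : x ≠ 0) (m : ℤ) :
    lam σ x (-m) = -σ * lam σ x m := by
  have h1 : x ^ m ≠ 0 := zpow_ne_zero _ hx0
  have hs : σ ≠ 0 := by rintro rfl; norm_num at hσ
  have e : x ^ (2 * m) = x ^ m * x ^ m := by rw [two_mul, zpow_add₀ hx0]
  have e' : x ^ (2 * -m) = (x ^ m * x ^ m)⁻¹ := by rw [mul_neg, zpow_neg, e]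
  rw [lam, lam, e, e', zpow_neg]
  have h2 : 1 - σ * (x ^ m * x ^ m)⁻¹ = -σ * (1 - σ * (x ^ m * x ^ m)) / (x ^ m * x ^ m) := by
    field_simp
    linear_combination (-(x ^ m) ^ 2) * hσ
  have h3 : (-σ)⁻¹ = -σ := by
    rcases sq_eq_one_iff.mp hσ with rfl | rfl <;> norm_num
  rw [h2, div_div_eq_mul_div, mul_comm (-σ) (1 - _), ← div_div, div_eq_mul_inv _ (-σ), h3]
  field_simp

lemma norm_one_sub_ge {σ x : ℂ} (hσ : σ ^ 2 = 1) (hx : ‖x‖ < 1) {n : ℕ} (hn : n ≠ 0) :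
    1 - ‖x‖ ^ 2 ≤ ‖1 - σ * x ^ (2 * n)‖ := by
  have h1 : ‖σ * x ^ (2 * n)‖ ≤ ‖x‖ ^ 2 := by
    rw [norm_mul, norm_eq_one_of_sq hσ, one_mul, norm_pow]
    exact pow_le_pow_of_le_one (norm_nonneg _) hx.le (by omega)
  have h2 := norm_sub_norm_le (1 : ℂ) (σ * x ^ (2 * n))
  rw [norm_one] at h2
  linarith

lemma one_sub_norm_sq_pos {x : ℂ} (hx : ‖x‖ < 1) : 0 < 1 - ‖x‖ ^ 2 := by
  have := pow_lt_one₀ (norm_nonneg x) hx two_ne_zero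
  linarith

lemma norm_lam_natCast_le {σ x : ℂ} (hσ : σ ^ 2 = 1) (hx : ‖x‖ < 1) (n : ℕ) :
    ‖lam σ x n‖ ≤ (1 - ‖x‖ ^ 2)⁻¹ * ‖x‖ ^ n := by
  have hp := one_sub_norm_sq_pos hx
  rcases eq_or_ne n 0 with rfl | hn
  · have h1 : (1 : ℝ) ≤ (1 - ‖x‖ ^ 2)⁻¹ := by
      rw [one_le_inv₀ hp]
      have := sq_nonneg ‖x‖
      linarith
    rcases sq_eq_one_iff.mp hσ with h | h
    -- For σ = 1 the denominator at n = 0 vanishes and the coefficient is 0 by the convention on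
    -- division.
    · simpa [lam, h] using by linarith
    · have : lam σ x (0 : ℕ) = 1 / 2 := by simp [lam, h]; norm_num
      rw [this]
      norm_num
      linarith
  · rw [lam, show (2 * (n : ℤ)) = ((2 * n : ℕ) : ℤ) by push_cast; rfl, zpow_natCast, zpow_natCast,
      norm_div, norm_pow, inv_mul_eq_div]
    exact div_le_div_of_nonneg_left (by positivity) hp (norm_one_sub_ge hσ hx hn)

lemma summable_lam_nat {σ x : ℂ} (hσ : σ ^ 2 = 1) (hx : ‖x‖ < 1) (j : ℕ) :
    Summable fun n : ℕ => ‖(n : ℂ) ^ j * lam σ x n‖ := by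
  have h := (summable_pow_mul_geometric_of_norm_lt_one j (r := ‖x‖) (by simpa using hx)).mul_left
    (1 - ‖x‖ ^ 2)⁻¹
  refine Summable.of_nonneg_of_le (fun _ => norm_nonneg _) (fun n => ?_) h
  rw [norm_mul, norm_pow, Complex.norm_natCast]
  calc (n : ℝ) ^ j * ‖lam σ x n‖ ≤ n ^ j * ((1 - ‖x‖ ^ 2)⁻¹ * ‖x‖ ^ n) := by
        gcongr; exact norm_lam_natCast_le hσ hx n
    _ = _ := by ring

lemma summable_lam {σ x : ℂ} (hσ : σ ^ 2 = 1) (hx0 : x ≠ 0) (hx : ‖x‖ < 1) (j : ℕ) :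
    Summable fun m : ℤ => ‖(m : ℂ) ^ j * lam σ x m‖ := by
  refine Summable.of_nat_of_neg ?_ ?_
  · simpa using! summable_lam_nat hσ hx j
  · refine (summable_lam_nat hσ hx j).congr fun n => ?_
    rw [lam_neg hσ hx0]
    simp [norm_eq_one_of_sq hσ]

lemma summable_lam_arith {σ x : ℂ} (hσ : σ ^ 2 = 1) (hx0 : x ≠ 0) (hx : ‖x‖ < 1) (j : ℕ) (δ : ℤ) :
    Summable fun m : ℤ => ‖((2 * m + δ : ℤ) : ℂ) ^ j * lam σ x (2 * m + δ)‖ :=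
  (summable_lam hσ hx0 hx j).comp_injective (i := fun m : ℤ => 2 * m + δ) fun a b h => by
    simp only at h
    omega

/-! ### Infinite products over odd and even exponents -/

lemma norm_sq_lt_one {x : ℂ} (hx : ‖x‖ < 1) : ‖x ^ 2‖ < 1 := by
  rw [norm_pow]
  exact pow_lt_one₀ (norm_nonneg _) hx two_ne_zero

lemma multipliable_one_add_mul {y : ℂ} (hy : ‖y‖ < 1) (s : ℂ) (c : ℕ) :
    Multipliable fun i : ℕ => 1 + s * y ^ (2 * i + c) := by
  refine multipliable_one_add_of_summable ?_
  refine ((summable_geometric_of_lt_one (norm_nonneg (y ^ 2)) (norm_sq_lt_one hy)).mul_left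
      (‖s‖ * ‖y‖ ^ c)).congr fun i => ?_
  simp only [norm_mul, norm_pow]
  ring

lemma tendsto_prod_range {s y : ℂ} (hy : ‖y‖ < 1) (c : ℕ) :
    Tendsto (fun N => ∏ i ∈ range N, (1 + s * y ^ (2 * i + c))) atTop
      (𝓝 (∏' i : ℕ, (1 + s * y ^ (2 * i + c)))) :=
  (multipliable_one_add_mul hy s c).tendsto_prod_tprod_nat

lemma tprod_ne_zero {s y : ℂ} (hs : s ^ 2 = 1) (hy : ‖y‖ < 1) {c : ℕ} (hc : c ≠ 0) :
    ∏' i : ℕ, (1 + s * y ^ (2 * i + c)) ≠ 0 := by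
  refine tprod_one_add_ne_zero_of_summable (fun i => ?_) ?_
  · rcases sq_eq_one_iff.mp hs with rfl | rfl
    · simpa using one_add_pow_ne_zero hy (n := 2 * i + c) (by omega)
    · simpa [sub_eq_add_neg] using one_sub_pow_ne_zero hy (n := 2 * i + c) (by omega)
  refine ((summable_geometric_of_lt_one (norm_nonneg (y ^ 2))
    (by rw [norm_pow]; exact pow_lt_one₀ (norm_nonneg _) hy two_ne_zero)).mul_left
      (‖s‖ * ‖y‖ ^ c)).congr fun i => ?_
  simp only [norm_mul, norm_pow]
  ring

/-- `∏ (1 - y^(2i+1))`. -/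
def oddMinus (y : ℂ) : ℂ := ∏' i : ℕ, (1 + (-1) * y ^ (2 * i + 1))
/-- `∏ (1 + y^(2i+1))`. -/
def oddPlus (y : ℂ) : ℂ := ∏' i : ℕ, (1 + 1 * y ^ (2 * i + 1))
/-- `∏ (1 - y^(2i+2))`. -/
def evenMinus (y : ℂ) : ℂ := ∏' i : ℕ, (1 + (-1) * y ^ (2 * i + 2))
/-- `∏ (1 + y^(2i+2))`. -/
def evenPlus (y : ℂ) : ℂ := ∏' i : ℕ, (1 + 1 * y ^ (2 * i + 2))

lemma tendsto_oddMinus {y : ℂ} (hy : ‖y‖ < 1) :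
    Tendsto (fun N => ∏ i ∈ range N, (1 - y ^ (2 * i + 1))) atTop (𝓝 (oddMinus y)) := by
  simpa [oddMinus, sub_eq_add_neg] using tendsto_prod_range (s := -1) hy 1

lemma tendsto_oddPlus {y : ℂ} (hy : ‖y‖ < 1) :
    Tendsto (fun N => ∏ i ∈ range N, (1 + y ^ (2 * i + 1))) atTop (𝓝 (oddPlus y)) := by
  simpa [oddPlus] using tendsto_prod_range (s := 1) hy 1

lemma tendsto_evenMinus {y : ℂ} (hy : ‖y‖ < 1) :
    Tendsto (fun N => ∏ i ∈ range N, (1 - y ^ (2 * i + 2))) atTop (𝓝 (evenMinus y)) := by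
  simpa [evenMinus, sub_eq_add_neg] using tendsto_prod_range (s := -1) hy 2

lemma tendsto_evenPlus {y : ℂ} (hy : ‖y‖ < 1) :
    Tendsto (fun N => ∏ i ∈ range N, (1 + y ^ (2 * i + 2))) atTop (𝓝 (evenPlus y)) := by
  simpa [evenPlus] using tendsto_prod_range (s := 1) hy 2

lemma tendsto_evenPlus_shift {y : ℂ} (hy : ‖y‖ < 1) :
    Tendsto (fun N => ∏ i ∈ range (N + 1), (1 + y ^ (2 * i))) atTop (𝓝 (2 * evenPlus y)) := by
  refine ((tendsto_evenPlus hy).const_mul 2).congr fun N => ?_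
  rw [Finset.prod_range_succ', mul_comm]
  rw [mul_zero, pow_zero, one_add_one_eq_two]
  rfl

lemma oddMinus_ne_zero {y : ℂ} (hy : ‖y‖ < 1) : oddMinus y ≠ 0 :=
  tprod_ne_zero (by norm_num) hy one_ne_zero
lemma oddPlus_ne_zero {y : ℂ} (hy : ‖y‖ < 1) : oddPlus y ≠ 0 :=
  tprod_ne_zero (by norm_num) hy one_ne_zero
lemma evenMinus_ne_zero {y : ℂ} (hy : ‖y‖ < 1) : evenMinus y ≠ 0 :=
  tprod_ne_zero (by norm_num) hy two_ne_zero
lemma evenPlus_ne_zero {y : ℂ} (hy : ‖y‖ < 1) : evenPlus y ≠ 0 :=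
  tprod_ne_zero (by norm_num) hy two_ne_zero

lemma tendsto_ratioProd {y : ℂ} (hy : ‖y‖ < 1) :
    Tendsto (ratioProd y) atTop (𝓝 (oddMinus y / evenMinus y)) := by
  refine ((tendsto_oddMinus hy).div (tendsto_evenMinus hy) (evenMinus_ne_zero hy)).congr fun N => ?_
  simp [ratioProd, Finset.prod_div_distrib]

/-! ### Bilateral summation and two special cases -/

/-- A special case of Ramanujan's bilateral summation formula. -/
lemma bilateral_sum {y : ℂ} (hy0 : y ≠ 0) (hy : ‖y‖ < 1) (a : ℂ)
    (ha : ∀ j : ℤ, 1 - a * y ^ (2 * j) ≠ 0)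
    (hs : Summable fun j : ℤ => ‖y ^ j / (1 - a * y ^ (2 * j))‖) {L : ℂ}
    (hL : Tendsto (fun N : ℕ => (∏ i ∈ range N, (y ^ (2 * i + 1) - a) / (y ^ (2 * i + 2) - a)) *
      (∏ i ∈ range N, (1 - a * y ^ (2 * i + 1))) / ∏ i ∈ range (N + 1), (1 - a * y ^ (2 * i)))
      atTop (𝓝 L)) :
    (oddMinus y / evenMinus y) ^ 2 * ∑' j : ℤ, y ^ j / (1 - a * y ^ (2 * j)) = L := by
  obtain ⟨B, hB⟩ := (tendsto_ratioProd hy).norm.bddAbove_range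
  have hB' : ∀ n, ‖ratioProd y n‖ ≤ B := fun n => hB ⟨n, rfl⟩
  have hB0 : 0 ≤ B := (norm_nonneg _).trans (hB' 0)
  set f : ℕ → ℤ → ℂ := fun N j => if j ∈ Finset.Icc (-N : ℤ) N then
    y ^ j * ratioProd y (N + j).toNat * ratioProd y (N - j).toNat / (1 - a * y ^ (2 * j)) else 0
  have h1 : Tendsto (fun N => ∑' j, f N j) atTop
      (𝓝 (∑' j : ℤ, (oddMinus y / evenMinus y) ^ 2 * (y ^ j / (1 - a * y ^ (2 * j))))) := by
    -- Both weights `ratioProd` tend to the same limit and are bounded by B, so the summable kernel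
    -- times B² dominates.
    refine tendsto_tsum_of_dominated_convergence (hs.mul_left (B ^ 2)) (fun j => ?_)
      (Eventually.of_forall fun N j => ?_)
    · have t1 : Tendsto (fun N : ℕ => ((N : ℤ) + j).toNat) atTop atTop :=
        tendsto_atTop_atTop.mpr fun b => ⟨b + j.natAbs, fun c hc => by omega⟩
      have t2 : Tendsto (fun N : ℕ => ((N : ℤ) - j).toNat) atTop atTop :=
        tendsto_atTop_atTop.mpr fun b => ⟨b + j.natAbs, fun c hc => by omega⟩
      have t3 := (((tendsto_ratioProd hy).comp t1).mul ((tendsto_ratioProd hy).comp t2)).mul_const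
        (y ^ j / (1 - a * y ^ (2 * j)))
      rw [← sq] at t3
      refine t3.congr' ?_
      filter_upwards [eventually_ge_atTop j.natAbs] with N hN
      have : j ∈ Finset.Icc (-N : ℤ) N := by rw [Finset.mem_Icc]; omega
      simp only [f, this, if_true, Function.comp]
      ring
    · by_cases hj : j ∈ Finset.Icc (-N : ℤ) N
      · simp only [f, hj, if_true]
        rw [show y ^ j * ratioProd y (N + j).toNat * ratioProd y (N - j).toNat /
          (1 - a * y ^ (2 * j)) = ratioProd y (N + j).toNat * ratioProd y (N - j).toNat *
          (y ^ j / (1 - a * y ^ (2 * j))) by ring, norm_mul, norm_mul, sq]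
        gcongr <;> exact hB' _
      · simp only [f, hj, if_false, norm_zero]
        positivity
  rw [tsum_mul_left] at h1
  refine tendsto_nhds_unique h1 (hL.congr fun N => ?_)
  rw [← sum_ratioProd_symm hy0 hy N a ha, tsum_eq_sum (s := Finset.Icc (-N : ℤ) N)]
  · exact Finset.sum_congr rfl fun j hj => by simp only [f, hj, if_true]
  · intro j hj
    simp only [f, hj, if_false]

lemma one_add_zpow_ne_zero {y : ℂ} (hy : ‖y‖ < 1) (m : ℤ) : 1 + y ^ m ≠ 0 := by
  rcases eq_or_ne m 0 with rfl | hm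
  · norm_num
  intro h
  have h1 : ‖y‖ ^ m = 1 := by rw [← norm_zpow, eq_neg_of_add_eq_zero_right h, norm_neg, norm_one]
  exact hm ((zpow_eq_one_iff_right₀ (norm_nonneg _) hy.ne).mp h1)

lemma one_sub_zpow_ne_zero {y : ℂ} (hy : ‖y‖ < 1) {m : ℤ} (hm : m ≠ 0) :
    1 - y ^ m ≠ 0 := by
  intro h
  have h1 : ‖y‖ ^ m = 1 := by rw [← norm_zpow, ← sub_eq_zero.mp h, norm_one]
  exact hm ((zpow_eq_one_iff_right₀ (norm_nonneg _) hy.ne).mp h1)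

/-- This is `bilateral_sum` at a = -1; the factor 2 is the i = 0 term 1 + y^0 of the denominator. -/
lemma tsum_even_eq {y : ℂ} (hy0 : y ≠ 0) (hy : ‖y‖ < 1) :
    2 * ∑' j : ℤ, y ^ j / (1 + y ^ (2 * j)) =
      (oddPlus y * evenMinus y / (evenPlus y * oddMinus y)) ^ 2 := by
  have hs : Summable fun j : ℤ => ‖y ^ j / (1 - (-1) * y ^ (2 * j))‖ := by
    simpa [lam] using summable_lam (σ := -1) (by norm_num) hy0 hy 0
  have h := bilateral_sum hy0 hy (-1) (fun j => by simpa using one_add_zpow_ne_zero hy _) hs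
    (L := oddPlus y / evenPlus y * oddPlus y / (2 * evenPlus y)) (by
      refine (((tendsto_oddPlus hy).div (tendsto_evenPlus hy) (evenPlus_ne_zero hy)).mul
        (tendsto_oddPlus hy)).div (tendsto_evenPlus_shift hy)
        (mul_ne_zero two_ne_zero (evenPlus_ne_zero hy)) |>.congr fun N => ?_
      simp [Finset.prod_div_distrib, add_comm])
  have h1 := oddMinus_ne_zero hy
  have h2 := evenMinus_ne_zero hy
  have h3 := evenPlus_ne_zero hy
  simp only [neg_mul, one_mul, sub_neg_eq_add] at h
  field_simp at h ⊢
  linear_combination h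

/-- This is `bilateral_sum` at a = -y, where each factor y^(2i+1) + y or y^(2i+2) + y sheds a y and
the surplus powers cancel. -/
lemma tsum_odd_eq {y : ℂ} (hy0 : y ≠ 0) (hy : ‖y‖ < 1) :
    ∑' j : ℤ, y ^ j / (1 + y ^ (2 * j + 1)) =
      2 * (evenPlus y * evenMinus y / (oddPlus y * oddMinus y)) ^ 2 := by
  have e : ∀ j : ℤ, 1 - (-y) * y ^ (2 * j) = 1 + y ^ (2 * j + 1) := fun j => by
    rw [zpow_add_one₀ hy0]; ring
  have hs : Summable fun j : ℤ => ‖y ^ j / (1 - (-y) * y ^ (2 * j))‖ := by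
    -- With a square root x of y, the terms are x⁻¹ times Lambert coefficients at odd indices, whose
    -- summability is known.
    obtain ⟨x, hx⟩ : ∃ x, x ^ 2 = y := IsAlgClosed.exists_pow_nat_eq y two_pos
    have hx0 : x ≠ 0 := by rintro rfl; exact hy0 (by rw [← hx]; norm_num)
    have hx1 : ‖x‖ < 1 := by
      rw [← hx, norm_pow] at hy
      exact (pow_lt_one_iff_of_nonneg (norm_nonneg _) two_ne_zero).mp hy
    refine ((summable_lam_arith (σ := -1) (by norm_num) hx0 hx1 0 1).mul_left ‖x⁻¹‖).congr
      fun j => ?_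
    rw [← norm_mul, e, lam, ← hx]
    congr 1
    rw [zpow_add_one₀ hx0, ← zpow_natCast x 2, ← zpow_mul, ← zpow_mul]
    push_cast
    field_simp
    ring_nf
  have h := bilateral_sum hy0 hy (-y) (fun j => by rw [e]; exact one_add_zpow_ne_zero hy _) hs
    (L := 2 * evenPlus y / oddPlus y * evenPlus y / oddPlus y) (by
      have t1 : Tendsto (fun N : ℕ => 1 + y ^ (2 * N)) atTop (𝓝 1) := by
        have := (tendsto_pow_atTop_nhds_zero_of_norm_lt_one
          (show ‖y ^ 2‖ < 1 by rw [norm_pow]; exact pow_lt_one₀ (norm_nonneg _) hy two_ne_zero)).const_add 1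
        simpa [← pow_mul] using this
      have t2 := (((tendsto_evenPlus_shift hy).div t1 one_ne_zero).div (tendsto_oddPlus hy)
        (oddPlus_ne_zero hy)).mul (tendsto_evenPlus hy)
      have t3 := t2.div ((tendsto_oddPlus hy).comp (tendsto_add_atTop_nat 1)) (oddPlus_ne_zero hy)
      rw [div_one] at t3
      refine t3.congr fun N => ?_
      simp only [Function.comp, Pi.div_apply]
      congr 1
      · congr 1
        · rw [Finset.prod_range_succ, mul_div_cancel_right₀, ← Finset.prod_div_distrib]
          · refine Finset.prod_congr rfl fun i _ => ?_
            rw [show y ^ (2 * i + 1) - -y = y * (1 + y ^ (2 * i)) by ring,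
              show y ^ (2 * i + 2) - -y = y * (1 + y ^ (2 * i + 1)) by ring, mul_div_mul_left _ _ hy0]
          · have := one_add_zpow_ne_zero hy (2 * N : ℕ)
            simpa only [zpow_natCast] using this
        · exact Finset.prod_congr rfl fun i _ => by ring
      · exact Finset.prod_congr rfl fun i _ => by ring)
  simp_rw [e] at h
  have h1 := oddMinus_ne_zero hy
  have h2 := evenMinus_ne_zero hy
  have h3 := oddPlus_ne_zero hy
  field_simp at h ⊢
  linear_combination h

/-! ### Sums of kinks -/

/-- The indicator function of the nonnegative integers. -/
def step (m : ℤ) : ℂ := if 0 ≤ m then 1 else 0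

lemma tsum_step_succ_sub (n : ℤ) : HasSum (fun l => step (n + 1 - l) - step (n - l)) 1 := by
  have : (fun l => step (n + 1 - l) - step (n - l)) = fun l => if l = n + 1 then 1 else 0 := by
    ext l
    unfold step
    split_ifs <;> first | omega | norm_num
  rw [this]
  exact hasSum_ite_eq _ _

lemma summable_step_interval (n : ℤ) : Summable fun l => step l + step (n - l) - 1 := by
  refine summable_of_ne_finset_zero (s := Finset.Icc (-|n|) |n|) fun l hl => ?_
  rw [Finset.mem_Icc] at hl
  unfold step
  have h1 := neg_abs_le n
  have h2 := le_abs_self n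
  split_ifs <;> first | omega | norm_num

/-- The sum of two kinks with reflection symmetries. -/
lemma tsum_kinks {g h : ℤ → ℂ} {δ ε : ℤ} (hg : ∀ l, g (-δ - l) = 1 - g l)
    (hh : ∀ l, h (-ε - l) = 1 - h l) (sg : Summable fun l => g l - step l)
    (sh : Summable fun l => h l - step l) (n : ℤ) :
    ∑' l, (g l + h (n - l) - 1) = n + (δ + ε) / 2 := by
  have hs : ∀ n, Summable fun l => g l + h (n - l) - 1 := fun n => by
    have s2 : Summable fun l => h (n - l) - step (n - l) :=
      sh.comp_injective (sub_right_injective (b := n))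
    refine ((sg.add s2).add (summable_step_interval n)).congr fun l => ?_
    ring
  set T : ℤ → ℂ := fun n => ∑' l, (g l + h (n - l) - 1) with hT
  -- Moving one kink by a unit adds exactly 1: the differences from `step` have
  -- translation-invariant sums, and `step` itself contributes 1.
  have succ : ∀ n, T (n + 1) = T n + 1 := fun n => by
    have s1 : Summable fun l => h (n - l) - step (n - l) :=
      sh.comp_injective (sub_right_injective (b := n))
    have s2 : Summable fun l => h (n + 1 - l) - step (n + 1 - l) :=
      sh.comp_injective (sub_right_injective (b := n + 1))
    have e1 : ∑' l, (h (n - l) - step (n - l)) = ∑' l, (h l - step l) :=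
      (Equiv.subLeft n).tsum_eq (fun l => h l - step l)
    have e2 : ∑' l, (h (n + 1 - l) - step (n + 1 - l)) = ∑' l, (h l - step l) :=
      (Equiv.subLeft (n + 1)).tsum_eq (fun l => h l - step l)
    have h1 := ((hs n).hasSum.add (s2.hasSum.sub s1.hasSum)).add (tsum_step_succ_sub n)
    rw [e1, e2, sub_self, add_zero] at h1
    rw [← h1.tsum_eq]
    exact tsum_congr fun l => by ring
  have lin : ∀ n, T n = T 0 + n := fun n => by
    induction n using Int.induction_on with
    | zero => simp
    | succ i ih => rw [succ, ih]; push_cast; ring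
    | pred i ih =>
      have := succ (-i - 1)
      rw [sub_add_cancel, ih] at this
      push_cast at this ⊢
      linear_combination -this
  -- The reflection l ↦ -δ - l negates the sum; this fixes the constant term of the linear function
  -- T.
  have hrefl : T 0 = -T (-δ - ε) := by
    simp only [hT]
    rw [← (Equiv.subLeft (-δ)).tsum_eq, ← tsum_neg]
    refine tsum_congr fun l => ?_
    simp only [Equiv.subLeft_apply]
    rw [hg, show 0 - (-δ - l) = -ε - (-δ - ε - l) by ring, hh]
    ring
  have h2 := lin (-δ - ε)
  have h3 := lin n
  push_cast at h2
  linear_combination h3 + hrefl / 2 - h2 / 2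

lemma fermi_neg {σ x : ℂ} (hσ : σ ^ 2 = 1) (hx0 : x ≠ 0) {m : ℤ} (hm : 1 - σ * x ^ (2 * m) ≠ 0) :
    fermi σ x (-m) = 1 - fermi σ x m := by
  have h1 : x ^ (2 * m) ≠ 0 := zpow_ne_zero _ hx0
  have h2 : x ^ (2 * m) - σ ≠ 0 := by
    intro h
    apply hm
    rw [sub_eq_zero.mp h]
    linear_combination -hσ
  have e : 1 - σ * (x ^ (2 * m))⁻¹ = (x ^ (2 * m) - σ) / x ^ (2 * m) := by field_simp
  rw [fermi, fermi, mul_neg, zpow_neg, e]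
  generalize x ^ (2 * m) = X at *
  rw [one_div_div, eq_sub_iff_add_eq, div_add_div _ _ h2 hm, div_eq_one_iff_eq (mul_ne_zero h2 hm)]
  linear_combination -X * hσ

lemma one_sub_mul_natCast_ne_zero {σ x : ℂ} (hσ : σ ^ 2 = 1) (hx : ‖x‖ < 1) (n : ℕ) :
    1 - σ * x ^ (2 * ((n + 1 : ℕ) : ℤ)) ≠ 0 := by
  have h := norm_one_sub_ge hσ hx n.succ_ne_zero
  rw [← norm_pos_iff, show 2 * ((n + 1 : ℕ) : ℤ) = ((2 * (n + 1) : ℕ) : ℤ) by push_cast; ring,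
    zpow_natCast]
  exact (one_sub_norm_sq_pos hx).trans_le h

lemma summable_fermi_nat {σ x : ℂ} (hσ : σ ^ 2 = 1) (hx : ‖x‖ < 1) :
    Summable fun n : ℕ => fermi σ x ((n + 1 : ℕ) : ℤ) - 1 := by
  have h := (summable_nat_add_iff 1).mpr (summable_lam_nat hσ hx 0)
  refine Summable.of_norm_bounded h fun n => ?_
  have e : fermi σ x ((n + 1 : ℕ) : ℤ) - 1 =
      σ * x ^ (n + 1) * lam σ x ((n + 1 : ℕ) : ℤ) := by
    have h1 := one_sub_mul_natCast_ne_zero hσ hx n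
    rw [fermi, lam]
    rw [show 2 * ((n + 1 : ℕ) : ℤ) = ((2 * (n + 1) : ℕ) : ℤ) by push_cast; ring,
      zpow_natCast] at h1 ⊢
    rw [zpow_natCast]
    field_simp
    ring
  rw [e, norm_mul, norm_mul, norm_eq_one_of_sq hσ, one_mul, pow_zero, one_mul, norm_pow]
  exact mul_le_of_le_one_left (norm_nonneg _) (pow_le_one₀ (norm_nonneg _) hx.le)

lemma summable_fermi {σ x : ℂ} (hσ : σ ^ 2 = 1) (hx0 : x ≠ 0) (hx : ‖x‖ < 1) :
    Summable fun m : ℤ => fermi σ x m - step m := by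
  have h := summable_fermi_nat hσ hx
  refine Summable.of_nat_of_neg ?_ ?_
  · rw [← summable_nat_add_iff 1]
    refine h.congr fun n => ?_
    rw [step, if_pos (by positivity)]
  · rw [← summable_nat_add_iff 1]
    refine h.neg.congr fun n => ?_
    rw [step, if_neg (by push_cast; omega),
      fermi_neg hσ hx0 (one_sub_mul_natCast_ne_zero hσ hx n)]
    ring

lemma summable_fermi_arith {σ x : ℂ} (hσ : σ ^ 2 = 1) (hx0 : x ≠ 0) (hx : ‖x‖ < 1) (δ : ℤ) :
    Summable fun l : ℤ => fermi σ x (2 * l + δ) - step l := by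
  have h1 : Summable fun l : ℤ => fermi σ x (2 * l + δ) - step (2 * l + δ) :=
    (summable_fermi hσ hx0 hx).comp_injective (i := fun m : ℤ => 2 * m + δ) fun a b h => by
      simp only at h
      omega
  have h2 : Summable fun l : ℤ => step (2 * l + δ) - step l := by
    refine summable_of_ne_finset_zero (s := Finset.Icc (-|δ|) |δ|) fun l hl => ?_
    rw [Finset.mem_Icc] at hl
    unfold step
    have h1 := neg_abs_le δ
    have h2 := le_abs_self δ
    split_ifs <;> first | omega | norm_num
  refine (h1.add h2).congr fun l => ?_
  ring

/-! ### Fourier series and the Jacobi differential system -/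

/-- The `j`-th derivative of the Fourier series with coefficients `lam σ x` on the residue class
of `δ` modulo `2`. -/
def lamSeries (σ x : ℂ) (δ : ℤ) (j : ℕ) (t : ℝ) : ℂ :=
  ∑' m : ℤ, (Complex.I * ((2 * m + δ : ℤ) : ℂ)) ^ j * lam σ x (2 * m + δ) *
    Complex.exp (Complex.I * ((2 * m + δ : ℤ) : ℂ) * t)

lemma norm_exp_I_mul (n : ℤ) (t : ℝ) : ‖Complex.exp (Complex.I * (n : ℂ) * t)‖ = 1 := by
  rw [show Complex.I * (n : ℂ) * t = ((n * t : ℝ) : ℂ) * Complex.I by push_cast; ring]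
  exact Complex.norm_exp_ofReal_mul_I _

lemma norm_lamSeries_term (σ x : ℂ) (j : ℕ) (t : ℝ) (n : ℤ) :
    ‖(Complex.I * (n : ℂ)) ^ j * lam σ x n * Complex.exp (Complex.I * (n : ℂ) * t)‖ =
      ‖(n : ℂ) ^ j * lam σ x n‖ := by
  rw [norm_mul, norm_exp_I_mul, mul_one, mul_pow, norm_mul, norm_mul, norm_mul, norm_pow,
    Complex.norm_I, one_pow, one_mul]

lemma summable_lamSeries {σ x : ℂ} (hσ : σ ^ 2 = 1) (hx0 : x ≠ 0) (hx : ‖x‖ < 1) (δ : ℤ) (j : ℕ)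
    (t : ℝ) : Summable fun m : ℤ => ‖(Complex.I * ((2 * m + δ : ℤ) : ℂ)) ^ j *
      lam σ x (2 * m + δ) * Complex.exp (Complex.I * ((2 * m + δ : ℤ) : ℂ) * t)‖ := by
  simp_rw [norm_lamSeries_term]
  exact summable_lam_arith hσ hx0 hx j δ

lemma hasDerivAt_lamSeries {σ x : ℂ} (hσ : σ ^ 2 = 1) (hx0 : x ≠ 0) (hx : ‖x‖ < 1) (δ : ℤ) (j : ℕ)
    (t : ℝ) : HasDerivAt (lamSeries σ x δ j) (lamSeries σ x δ (j + 1) t) t := by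
  let g : ℕ → ℤ → ℝ → ℂ := fun j m t => (Complex.I * ((2 * m + δ : ℤ) : ℂ)) ^ j *
    lam σ x (2 * m + δ) * Complex.exp (Complex.I * ((2 * m + δ : ℤ) : ℂ) * t)
  have hsum : Summable fun m => g j m t := (summable_lamSeries hσ hx0 hx δ j t).of_norm
  refine hasDerivAt_tsum (g := g j) (g' := g (j + 1)) (summable_lam_arith hσ hx0 hx (j + 1) δ)
    (fun m y => ?_) (fun m y => (norm_lamSeries_term σ x (j + 1) y _).le) hsum t
  have h1 : HasDerivAt (fun y : ℝ => Complex.exp (Complex.I * ((2 * m + δ : ℤ) : ℂ) * y))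
      (Complex.exp (Complex.I * ((2 * m + δ : ℤ) : ℂ) * y) *
        (Complex.I * ((2 * m + δ : ℤ) : ℂ) * 1)) y :=
    (((hasDerivAt_id y).ofReal_comp).const_mul _).cexp
  refine (h1.const_mul ((Complex.I * ((2 * m + δ : ℤ) : ℂ)) ^ j *
    lam σ x (2 * m + δ))).congr_deriv ?_
  simp only [g]
  ring

lemma lamSeries_add_two (σ x : ℂ) (δ : ℤ) (j : ℕ) (t : ℝ) :
    lamSeries σ x (δ + 2) j t = lamSeries σ x δ j t := by
  unfold lamSeries
  rw [← (Equiv.addRight (1 : ℤ)).tsum_eq (fun m : ℤ => (Complex.I * ((2 * m + δ : ℤ) : ℂ)) ^ j *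
    lam σ x (2 * m + δ) * Complex.exp (Complex.I * ((2 * m + δ : ℤ) : ℂ) * t))]
  refine tsum_congr fun m => ?_
  rw [Equiv.coe_addRight, show 2 * (m + 1) + δ = 2 * m + (δ + 2) by ring]

/-- With X = x^(2m) and Y = x^(2n), it rests on 1/(1-σX) + 1/(1-τY) - 1 = (1-στXY) / ((1-σX)(1-τY)).
-/
lemma lam_mul_lam {σ τ x : ℂ} (hx0 : x ≠ 0) {m n : ℤ} (hm : 1 - σ * x ^ (2 * m) ≠ 0)
    (hn : 1 - τ * x ^ (2 * n) ≠ 0) (hmn : 1 - σ * τ * x ^ (2 * (m + n)) ≠ 0) :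
    lam σ x m * lam τ x n = lam (σ * τ) x (m + n) * (fermi σ x m + fermi τ x n - 1) := by
  unfold lam fermi
  have e : x ^ (2 * (m + n)) = x ^ (2 * m) * x ^ (2 * n) := by rw [mul_add, zpow_add₀ hx0]
  rw [e] at hmn ⊢
  rw [zpow_add₀ hx0]
  generalize x ^ (2 * m) = X at *
  generalize x ^ (2 * n) = Y at *
  have h : 1 / (1 - σ * X) + 1 / (1 - τ * Y) - 1 =
      (1 - σ * τ * (X * Y)) / ((1 - σ * X) * (1 - τ * Y)) := by
    field_simp
    ring
  rw [h, div_mul_div_cancel₀ hmn, div_mul_div_comm]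

lemma tsum_mul_tsum_int {f g : ℤ → ℂ} (hf : Summable fun m => ‖f m‖) (hg : Summable fun m => ‖g m‖) :
    (∑' m, f m) * ∑' m, g m = ∑' n, ∑' l, f l * g (n - l) := by
  let e : ℤ × ℤ ≃ ℤ × ℤ :=
    ⟨fun p => (p.2, p.1 - p.2), fun p => (p.1 + p.2, p.1), fun p => by simp, fun p => by simp⟩
  have hs := (summable_mul_of_summable_norm hf hg)
  rw [tsum_mul_tsum_of_summable_norm hf hg, ← e.tsum_eq]
  exact (e.summable_iff.mpr hs).tsum_prod

/-- In the convolution at frequency 2n + δ + ε, `lam_mul_lam` pulls out the Lambert factor and the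
remaining kinks sum to (2n + δ + ε)/2, which is 1/(2i) times the symbol of d/dt. The nonvanishing
hypotheses restrict the sign 1 to odd residue classes, away from the pole at frequency 0. -/
lemma lamSeries_mul {σ τ x : ℂ} (hσ : σ ^ 2 = 1) (hτ : τ ^ 2 = 1) (hx0 : x ≠ 0) (hx : ‖x‖ < 1)
    (δ ε : ℤ) (hδ : ∀ m : ℤ, 1 - σ * x ^ (2 * (2 * m + δ)) ≠ 0)
    (hε : ∀ m : ℤ, 1 - τ * x ^ (2 * (2 * m + ε)) ≠ 0)
    (hδε : ∀ m : ℤ, 1 - σ * τ * x ^ (2 * (2 * m + (δ + ε))) ≠ 0) (t : ℝ) :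
    lamSeries σ x δ 0 t * lamSeries τ x ε 0 t =
      1 / (2 * Complex.I) * lamSeries (σ * τ) x (δ + ε) 1 t := by
  unfold lamSeries
  rw [tsum_mul_tsum_int (summable_lamSeries hσ hx0 hx δ 0 t) (summable_lamSeries hτ hx0 hx ε 0 t),
    ← tsum_mul_left]
  refine tsum_congr fun n => ?_
  have key := tsum_kinks (g := fun l => fermi σ x (2 * l + δ)) (h := fun l => fermi τ x (2 * l + ε))
    (δ := δ) (ε := ε)
    (fun l => by rw [← fermi_neg hσ hx0 (hδ l)]; congr 1; ring)
    (fun l => by rw [← fermi_neg hτ hx0 (hε l)]; congr 1; ring)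
    (summable_fermi_arith hσ hx0 hx δ) (summable_fermi_arith hτ hx0 hx ε) n
  have e : ∀ l : ℤ, (Complex.I * ((2 * l + δ : ℤ) : ℂ)) ^ 0 * lam σ x (2 * l + δ) *
      Complex.exp (Complex.I * ((2 * l + δ : ℤ) : ℂ) * t) *
      ((Complex.I * ((2 * (n - l) + ε : ℤ) : ℂ)) ^ 0 * lam τ x (2 * (n - l) + ε) *
      Complex.exp (Complex.I * ((2 * (n - l) + ε : ℤ) : ℂ) * t)) =
      lam (σ * τ) x (2 * n + (δ + ε)) *
      Complex.exp (Complex.I * ((2 * n + (δ + ε) : ℤ) : ℂ) * t) *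
      (fermi σ x (2 * l + δ) + fermi τ x (2 * (n - l) + ε) - 1) := fun l => by
    have h1 : (2 * l + δ) + (2 * (n - l) + ε) = 2 * n + (δ + ε) := by ring
    have h2 := lam_mul_lam hx0 (hδ l) (hε (n - l)) (by rw [h1]; exact hδε n)
    rw [h1] at h2
    have h3 : Complex.exp (Complex.I * ((2 * l + δ : ℤ) : ℂ) * t) *
        Complex.exp (Complex.I * ((2 * (n - l) + ε : ℤ) : ℂ) * t) =
        Complex.exp (Complex.I * ((2 * n + (δ + ε) : ℤ) : ℂ) * t) := by
      rw [← Complex.exp_add, ← h1]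
      congr 1
      push_cast
      ring
    rw [← h3, pow_zero, pow_zero, one_mul, one_mul]
    linear_combination Complex.exp (Complex.I * ((2 * l + δ : ℤ) : ℂ) * t) *
        Complex.exp (Complex.I * ((2 * (n - l) + ε : ℤ) : ℂ) * t) * h2
  simp_rw [e]
  rw [tsum_mul_left, key]
  have hI : Complex.I ≠ 0 := Complex.I_ne_zero
  push_cast
  field_simp

/-- `F k sn`, as a Fourier series. -/
def snSeries (x : ℂ) (t : ℝ) : ℂ := -2 * Complex.I * lamSeries 1 x 1 0 t
/-- The derivatives of `F k cn`, as Fourier series. -/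
def cnSeries (x : ℂ) (j : ℕ) (t : ℝ) : ℂ := 2 * lamSeries (-1) x 1 j t
/-- The derivatives of `F dn`, as Fourier series. -/
def dnSeries (x : ℂ) (j : ℕ) (t : ℝ) : ℂ := 2 * lamSeries (-1) x 0 j t

lemma hasDerivAt_cnSeries_succ {x : ℂ} (hx0 : x ≠ 0) (hx : ‖x‖ < 1) (j : ℕ) (t : ℝ) :
    HasDerivAt (cnSeries x j) (cnSeries x (j + 1) t) t :=
  (hasDerivAt_lamSeries (by norm_num) hx0 hx 1 j t).const_mul 2

lemma hasDerivAt_dnSeries_succ {x : ℂ} (hx0 : x ≠ 0) (hx : ‖x‖ < 1) (j : ℕ) (t : ℝ) :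
    HasDerivAt (dnSeries x j) (dnSeries x (j + 1) t) t :=
  (hasDerivAt_lamSeries (by norm_num) hx0 hx 0 j t).const_mul 2

lemma one_sub_neg_one_mul_ne_zero {x : ℂ} (hx : ‖x‖ < 1) (m : ℤ) : 1 - (-1) * x ^ m ≠ 0 := by
  simpa using one_add_zpow_ne_zero hx m

lemma hasDerivAt_snSeries {x : ℂ} (hx0 : x ≠ 0) (hx : ‖x‖ < 1) (t : ℝ) :
    HasDerivAt (snSeries x) (cnSeries x 0 t * dnSeries x 0 t) t := by
  have h := (hasDerivAt_lamSeries (σ := 1) (by norm_num) hx0 hx 1 0 t).const_mul (-2 * Complex.I)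
  have h2 := lamSeries_mul (σ := -1) (τ := -1) (by norm_num) (by norm_num) hx0 hx 1 0
    (fun m => one_sub_neg_one_mul_ne_zero hx _) (fun m => one_sub_neg_one_mul_ne_zero hx _)
    (fun m => by
      have := one_sub_zpow_ne_zero hx (m := 2 * (2 * m + (1 + 0))) (by omega)
      simpa using this) t
  rw [show (-1 : ℂ) * -1 = 1 by norm_num, show (1 : ℤ) + 0 = 1 by norm_num] at h2
  convert! h using 1
  rw [cnSeries, dnSeries, mul_mul_mul_comm, h2, one_div, mul_inv, Complex.inv_I]
  ring

lemma hasDerivAt_cnSeries {x : ℂ} (hx0 : x ≠ 0) (hx : ‖x‖ < 1) (t : ℝ) :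
    HasDerivAt (cnSeries x 0) (-(snSeries x t * dnSeries x 0 t)) t := by
  have h2 := lamSeries_mul (σ := 1) (τ := -1) (by norm_num) (by norm_num) hx0 hx 1 0
    (fun m => by
      have := one_sub_zpow_ne_zero hx (m := 2 * (2 * m + 1)) (by omega)
      simpa using this)
    (fun m => one_sub_neg_one_mul_ne_zero hx _)
    (fun m => by rw [one_mul]; exact one_sub_neg_one_mul_ne_zero hx _) t
  rw [one_mul, show (1 : ℤ) + 0 = 1 by norm_num] at h2
  convert! hasDerivAt_cnSeries_succ hx0 hx 0 t using 1
  have hI := Complex.I_sq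
  rw [cnSeries, snSeries, dnSeries, mul_mul_mul_comm, h2, one_div, mul_inv, Complex.inv_I]
  linear_combination (-2) * lamSeries (-1) x 1 1 t * hI

lemma hasDerivAt_dnSeries {x : ℂ} (hx0 : x ≠ 0) (hx : ‖x‖ < 1) (t : ℝ) :
    HasDerivAt (dnSeries x 0) (-(snSeries x t * cnSeries x 0 t)) t := by
  have h2 := lamSeries_mul (σ := 1) (τ := -1) (by norm_num) (by norm_num) hx0 hx 1 1
    (fun m => by
      have := one_sub_zpow_ne_zero hx (m := 2 * (2 * m + 1)) (by omega)
      simpa using this)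
    (fun m => one_sub_neg_one_mul_ne_zero hx _)
    (fun m => by rw [one_mul]; exact one_sub_neg_one_mul_ne_zero hx _) t
  -- The product of two odd classes lands in class 2, which is reindexed to class 0.
  rw [one_mul, show (1 : ℤ) + 1 = 0 + 2 by norm_num, lamSeries_add_two] at h2
  convert! hasDerivAt_dnSeries_succ hx0 hx 0 t using 1
  have hI := Complex.I_sq
  rw [cnSeries, snSeries, dnSeries, mul_mul_mul_comm, h2, one_div, mul_inv, Complex.inv_I]
  linear_combination (-2) * lamSeries (-1) x 0 1 t * hI

/-! ### Derivatives as homogeneous polynomials in the squares -/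

open MvPolynomial in
/-- The derivation `∂₀ - ∂₁ - ∂₂`. -/
def alternatingDeriv (P : MvPolynomial (Fin 3) ℤ) : MvPolynomial (Fin 3) ℤ :=
  pderiv 0 P - pderiv 1 P - pderiv 2 P

open MvPolynomial in
lemma isHomogeneous_X_mul_alternatingDeriv {P : MvPolynomial (Fin 3) ℤ} {n : ℕ}
    (hP : P.IsHomogeneous n) (i : Fin 3) : (X i * alternatingDeriv P).IsHomogeneous n := by
  have h : (alternatingDeriv P).IsHomogeneous (n - 1) := (hP.pderiv.sub hP.pderiv).sub hP.pderiv
  rcases n with _ | n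
  -- In degree 0 the truncated n - 1 would give the wrong degree, but P is then constant and its
  -- derivative vanishes.
  · rw [← totalDegree_zero_iff_isHomogeneous, totalDegree_eq_zero_iff_eq_C] at hP
    rw [alternatingDeriv, hP]
    simpa using isHomogeneous_zero _ _ _
  · have := (isHomogeneous_X ℤ i).mul h
    rwa [Nat.add_sub_cancel, add_comm] at this

open MvPolynomial in
-- The squares s², c², d² have derivatives 2w, -2w, -2w with the same w = scd, so a single
-- derivation computes all derivatives.
lemma hasDerivAt_aeval {X Y Z : ℝ → ℂ} {w : ℂ} {t : ℝ} (hX : HasDerivAt X (2 * w) t)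
    (hY : HasDerivAt Y (-(2 * w)) t) (hZ : HasDerivAt Z (-(2 * w)) t)
    (P : MvPolynomial (Fin 3) ℤ) :
    HasDerivAt (fun t => aeval ![X t, Y t, Z t] P)
      (2 * w * aeval ![X t, Y t, Z t] (alternatingDeriv P)) t := by
  induction P using MvPolynomial.induction_on with
  | C a =>
    simp only [algHom_C, alternatingDeriv, pderiv_C, sub_zero, map_zero, mul_zero]
    exact hasDerivAt_const _ _
  | add p q hp hq =>
    simp only [map_add]
    refine (hp.add hq).congr_deriv ?_
    simp only [alternatingDeriv, map_add, map_sub]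
    ring
  | mul_X p i hp =>
    simp only [map_mul, aeval_X]
    have hi : HasDerivAt (fun t => ![X t, Y t, Z t] i)
        (2 * w * aeval ![X t, Y t, Z t] (alternatingDeriv (MvPolynomial.X i))) t := by
      fin_cases i
      · exact hX.congr_deriv (by simp [alternatingDeriv, pderiv_X])
      · exact hY.congr_deriv (by simp [alternatingDeriv, pderiv_X])
      · exact hZ.congr_deriv (by simp [alternatingDeriv, pderiv_X])
    refine (hp.mul hi).congr_deriv ?_
    simp only [alternatingDeriv, map_sub, Derivation.leibniz, smul_eq_mul, map_add, map_mul, aeval_X]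
    ring

open MvPolynomial in
lemma aeval_smul_of_isHomogeneous {P : MvPolynomial (Fin 3) ℤ} {n : ℕ} (hP : P.IsHomogeneous n)
    (c : ℂ) (v : Fin 3 → ℂ) : aeval (fun i => c * v i) P = c ^ n * aeval v P := by
  rw [aeval_def, aeval_def, eval₂_eq', eval₂_eq', Finset.mul_sum]
  refine Finset.sum_congr rfl fun d hd => ?_
  have h : ∑ i, d i = n := by
    have := hP (mem_support_iff.mp hd)
    simpa [Finsupp.weight_apply, Finsupp.sum_fintype] using this
  simp_rw [mul_pow]
  rw [Finset.prod_mul_distrib, Finset.prod_pow_eq_pow_sum, h]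
  ring

/-- The differential system of the (rescaled) Jacobi elliptic functions, with `c j`, `d j` the
`j`-th derivatives of `c 0`, `d 0`. -/
structure JacobiSystem (s : ℝ → ℂ) (c d : ℕ → ℝ → ℂ) : Prop where
  deriv_s : ∀ t, HasDerivAt s (c 0 t * d 0 t) t
  deriv_c : ∀ t, HasDerivAt (c 0) (-(s t * d 0 t)) t
  deriv_d : ∀ t, HasDerivAt (d 0) (-(s t * c 0 t)) t
  succ_c : ∀ j t, HasDerivAt (c j) (c (j + 1) t) t
  succ_d : ∀ j t, HasDerivAt (d j) (d (j + 1) t) t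

namespace JacobiSystem

/-- Evaluation at the squares of the three functions. -/
def evalSq (s : ℝ → ℂ) (c d : ℕ → ℝ → ℂ) (t : ℝ) (P : MvPolynomial (Fin 3) ℤ) : ℂ :=
  MvPolynomial.aeval ![s t ^ 2, c 0 t ^ 2, d 0 t ^ 2] P

variable {s : ℝ → ℂ} {c d : ℕ → ℝ → ℂ}

lemma hasDerivAt_evalSq (h : JacobiSystem s c d) (P : MvPolynomial (Fin 3) ℤ) (t : ℝ) :
    HasDerivAt (fun t => evalSq s c d t P)
      (2 * (s t * c 0 t * d 0 t) * evalSq s c d t (alternatingDeriv P)) t := by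
  refine hasDerivAt_aeval ?_ ?_ ?_ P
  · exact ((h.deriv_s t).pow 2).congr_deriv (by simp; ring)
  · exact ((h.deriv_c t).pow 2).congr_deriv (by simp; ring)
  · exact ((h.deriv_d t).pow 2).congr_deriv (by simp; ring)

open MvPolynomial in
/-- Passage from even to odd derivatives of `c`. -/
lemma c_odd_of_even {m : ℕ} {P : MvPolynomial (Fin 3) ℤ} (h : JacobiSystem s c d)
    (hP : ∀ t, c (2 * m) t = c 0 t * evalSq s c d t P) (t : ℝ) :
    c (2 * m + 1) t = s t * d 0 t * evalSq s c d t (2 * (X 1 * alternatingDeriv P) - P) := by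
  have h1 := h.succ_c (2 * m) t
  rw [funext hP] at h1
  rw [h1.unique ((h.deriv_c t).mul (h.hasDerivAt_evalSq P t))]
  simp [evalSq]
  ring

open MvPolynomial in
lemma c_even_of_odd {m : ℕ} {P : MvPolynomial (Fin 3) ℤ} (h : JacobiSystem s c d)
    (hP : ∀ t, c (2 * m + 1) t = s t * d 0 t * evalSq s c d t P) (t : ℝ) :
    c (2 * (m + 1)) t = c 0 t * evalSq s c d t
      ((X 2 - X 0) * P + 2 * (X 0 * (X 2 * alternatingDeriv P))) := by
  have h1 := h.succ_c (2 * m + 1) t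
  rw [funext hP] at h1
  rw [show 2 * (m + 1) = 2 * m + 1 + 1 by ring,
    h1.unique (((h.deriv_s t).mul (h.deriv_d t)).mul (h.hasDerivAt_evalSq P t))]
  simp [evalSq]
  ring

open MvPolynomial in
lemma d_odd_of_even {m : ℕ} {P : MvPolynomial (Fin 3) ℤ} (h : JacobiSystem s c d)
    (hP : ∀ t, d (2 * m) t = d 0 t * evalSq s c d t P) (t : ℝ) :
    d (2 * m + 1) t = s t * c 0 t * evalSq s c d t (2 * (X 2 * alternatingDeriv P) - P) := by
  have h1 := h.succ_d (2 * m) t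
  rw [funext hP] at h1
  rw [h1.unique ((h.deriv_d t).mul (h.hasDerivAt_evalSq P t))]
  simp [evalSq]
  ring

open MvPolynomial in
lemma d_even_of_odd {m : ℕ} {P : MvPolynomial (Fin 3) ℤ} (h : JacobiSystem s c d)
    (hP : ∀ t, d (2 * m + 1) t = s t * c 0 t * evalSq s c d t P) (t : ℝ) :
    d (2 * (m + 1)) t = d 0 t * evalSq s c d t
      ((X 1 - X 0) * P + 2 * (X 0 * (X 1 * alternatingDeriv P))) := by
  have h1 := h.succ_d (2 * m + 1) t
  rw [funext hP] at h1
  rw [show 2 * (m + 1) = 2 * m + 1 + 1 by ring,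
    h1.unique (((h.deriv_s t).mul (h.deriv_c t)).mul (h.hasDerivAt_evalSq P t))]
  simp [evalSq]
  ring

open MvPolynomial in
lemma isHomogeneous_step {P : MvPolynomial (Fin 3) ℤ} {m : ℕ} (hP : P.IsHomogeneous m)
    (i j : Fin 3) : (2 * (X i * alternatingDeriv P) - P).IsHomogeneous m ∧
      ((X i - X j) * P + 2 * (X j * (X i * alternatingDeriv P))).IsHomogeneous (m + 1) := by
  have h2 : ∀ {Q : MvPolynomial (Fin 3) ℤ} {n : ℕ}, Q.IsHomogeneous n →
      (2 * Q).IsHomogeneous n := fun {Q n} hQ => by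
    rw [two_mul]; exact hQ.add hQ
  refine ⟨(h2 (isHomogeneous_X_mul_alternatingDeriv hP i)).sub hP, ?_⟩
  have h3 := ((isHomogeneous_X ℤ i).sub (isHomogeneous_X ℤ j)).mul hP
  have h4 := (isHomogeneous_X ℤ j).mul (isHomogeneous_X_mul_alternatingDeriv hP i)
  rw [add_comm] at h3 h4
  exact h3.add (h2 h4)

open MvPolynomial in
-- One P serves every system, which makes the final polynomial independent of τ. The squares are
-- kept as three independent variables, since eliminating one by d² - c² = const would spoil
-- homogeneity.
lemma exists_c_even (m : ℕ) : ∃ P : MvPolynomial (Fin 3) ℤ, P.IsHomogeneous m ∧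
    ∀ s c d, JacobiSystem s c d → ∀ t, c (2 * m) t = c 0 t * evalSq s c d t P := by
  induction m with
  | zero => exact ⟨1, isHomogeneous_one _ _, fun s c d _ t => by simp [evalSq]⟩
  | succ m ih =>
    obtain ⟨P, hP, h⟩ := ih
    exact ⟨_, (isHomogeneous_step (isHomogeneous_step hP 1 0).1 2 0).2,
      fun s c d hS t => c_even_of_odd hS (c_odd_of_even hS (h s c d hS)) t⟩

lemma exists_c_odd (m : ℕ) : ∃ P : MvPolynomial (Fin 3) ℤ, P.IsHomogeneous m ∧
    ∀ s c d, JacobiSystem s c d → ∀ t, c (2 * m + 1) t = s t * d 0 t * evalSq s c d t P := by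
  obtain ⟨P, hP, h⟩ := exists_c_even m
  exact ⟨_, (isHomogeneous_step hP 1 0).1, fun s c d hS t => c_odd_of_even hS (h s c d hS) t⟩

open MvPolynomial in
-- The point (0, 0, 1) corresponds to z = 0 at t = π/2; for m ≠ 0 each term of the recursion carries
-- a factor X 1 - X 0 or X 0 * X 1, which vanishes there. This is the source of ν(0) = 0.
lemma exists_d_even (m : ℕ) : ∃ P : MvPolynomial (Fin 3) ℤ, P.IsHomogeneous m ∧
    (m ≠ 0 → aeval ![(0 : ℤ), 0, 1] P = 0) ∧
    ∀ s c d, JacobiSystem s c d → ∀ t, d (2 * m) t = d 0 t * evalSq s c d t P := by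
  induction m with
  | zero => exact ⟨1, isHomogeneous_one _ _, by simp, fun s c d _ t => by simp [evalSq]⟩
  | succ m ih =>
    obtain ⟨P, hP, -, h⟩ := ih
    exact ⟨_, (isHomogeneous_step (isHomogeneous_step hP 2 0).1 1 0).2, by simp,
      fun s c d hS t => d_even_of_odd hS (d_odd_of_even hS (h s c d hS)) t⟩

/-- Both squares have derivative -2scd. -/
lemma sq_sub_sq (h : JacobiSystem s c d) (t u : ℝ) :
    d 0 t ^ 2 - c 0 t ^ 2 = d 0 u ^ 2 - c 0 u ^ 2 := by
  have hd : ∀ t, HasDerivAt (fun t => d 0 t ^ 2 - c 0 t ^ 2) 0 t := fun t =>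
    (((h.deriv_d t).pow 2).sub ((h.deriv_c t).pow 2)).congr_deriv (by simp; ring)
  exact is_const_of_deriv_eq_zero (fun t => (hd t).differentiableAt) (fun t => (hd t).deriv) t u

open MvPolynomial in
/-- Specialisation of a homogeneous polynomial in three variables. -/
lemma aeval_specialize {P : MvPolynomial (Fin 3) ℤ} {m : ℕ} (hP : P.IsHomogeneous m)
    (f : Fin 3 → Polynomial ℤ) (F x : ℂ) {v : Fin 3 → ℂ}
    (hv : ∀ i, v i = F ^ 2 * Polynomial.aeval x (f i)) :
    aeval v P = F ^ (2 * m) * Polynomial.aeval x (aeval f P) := by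
  rw [funext hv, aeval_smul_of_isHomogeneous hP, ← pow_mul]
  congr 1
  have := comp_aeval_apply (f := f) (Polynomial.aeval x) P
  rw [this]

lemma natDegree_aeval_le {P : MvPolynomial (Fin 3) ℤ} {m : ℕ} (hP : P.IsHomogeneous m)
    (f : Fin 3 → Polynomial ℤ) (hf : ∀ i, (f i).natDegree ≤ 1) :
    (MvPolynomial.aeval f P).natDegree ≤ m := by
  simpa using MvPolynomial.aeval_natDegree_le P hP.totalDegree_le f hf

/-- Even derivatives of `c` at a zero of `s`. -/
lemma exists_poly_c_even (m : ℕ) : ∃ p : Polynomial ℤ, p.natDegree ≤ m ∧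
    ∀ s c d, JacobiSystem s c d → ∀ (t : ℝ) (F z : ℂ), s t = 0 → c 0 t = F * z → d 0 t = F →
      c (2 * m) t = F ^ (2 * m + 1) * z * Polynomial.aeval (z ^ 2) p := by
  obtain ⟨P, hP, h⟩ := exists_c_even m
  refine ⟨MvPolynomial.aeval ![0, Polynomial.X, 1] P, natDegree_aeval_le hP _ ?_,
    fun s c d hS t F z h0 h1 h2 => ?_⟩
  · intro i; fin_cases i <;> simp
  · rw [h s c d hS, evalSq, aeval_specialize hP ![0, Polynomial.X, 1] F (z ^ 2), h1]
    · ring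
    · intro i; fin_cases i <;> simp [h0, h1, h2, mul_pow]

lemma natDegree_one_sub_X_le : (1 - Polynomial.X : Polynomial ℤ).natDegree ≤ 1 := by
  compute_degree

/-- Odd derivatives of `c` at a zero of `c`. -/
lemma exists_poly_c_odd (m : ℕ) : ∃ p : Polynomial ℤ, p.natDegree ≤ m ∧
    ∀ s c d, JacobiSystem s c d → ∀ (t : ℝ) (F z z' : ℂ), c 0 t = 0 → s t = F * z →
      d 0 t = F * z' → z' ^ 2 = 1 - z ^ 2 →
      c (2 * m + 1) t = F ^ (2 * m + 2) * z * z' * Polynomial.aeval (z ^ 2) p := by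
  obtain ⟨P, hP, h⟩ := exists_c_odd m
  refine ⟨MvPolynomial.aeval ![Polynomial.X, 0, 1 - Polynomial.X] P, natDegree_aeval_le hP _ ?_,
    fun s c d hS t F z z' h0 h1 h2 h3 => ?_⟩
  · intro i
    fin_cases i
    · simp
    · simp
    · exact natDegree_one_sub_X_le
  · rw [h s c d hS, evalSq, aeval_specialize hP ![Polynomial.X, 0, 1 - Polynomial.X] F (z ^ 2),
      h1, h2]
    · ring
    · intro i; fin_cases i <;> simp [h0, h1, h2, h3, mul_pow]

/-- Even derivatives of `d` at a zero of `c`. -/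
lemma exists_poly_d_even (m : ℕ) : ∃ p : Polynomial ℤ, p.natDegree ≤ m ∧
    (m ≠ 0 → p.eval 0 = 0) ∧
    ∀ s c d, JacobiSystem s c d → ∀ (t : ℝ) (F z z' : ℂ), c 0 t = 0 → s t = F * z →
      d 0 t = F * z' → z' ^ 2 = 1 - z ^ 2 →
      d (2 * m) t = F ^ (2 * m + 1) * z' * Polynomial.aeval (z ^ 2) p := by
  obtain ⟨P, hP, hP0, h⟩ := exists_d_even m
  refine ⟨MvPolynomial.aeval ![Polynomial.X, 0, 1 - Polynomial.X] P, natDegree_aeval_le hP _ ?_,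
    fun hm => ?_, fun s c d hS t F z z' h0 h1 h2 h3 => ?_⟩
  · intro i
    fin_cases i
    · simp
    · simp
    · exact natDegree_one_sub_X_le
  · have := MvPolynomial.comp_aeval_apply (f := ![Polynomial.X, 0, 1 - Polynomial.X])
      (Polynomial.aeval (0 : ℤ)) P
    have e : (fun i => Polynomial.aeval (0 : ℤ) ((![Polynomial.X, 0, 1 - Polynomial.X] :
        Fin 3 → Polynomial ℤ) i)) = ![0, 0, 1] := by
      funext i
      fin_cases i <;> simp
    rw [← Polynomial.coe_aeval_eq_eval, this, e, hP0 hm]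
  · rw [h s c d hS, evalSq, aeval_specialize hP ![Polynomial.X, 0, 1 - Polynomial.X] F (z ^ 2),
      h2]
    · ring
    · intro i; fin_cases i <;> simp [h0, h1, h2, h3, mul_pow]

end JacobiSystem

lemma jacobiSystem {x : ℂ} (hx0 : x ≠ 0) (hx : ‖x‖ < 1) :
    JacobiSystem (snSeries x) (cnSeries x) (dnSeries x) where
  deriv_s := hasDerivAt_snSeries hx0 hx
  deriv_c := hasDerivAt_cnSeries hx0 hx
  deriv_d := hasDerivAt_dnSeries hx0 hx
  succ_c := hasDerivAt_cnSeries_succ hx0 hx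
  succ_d := hasDerivAt_dnSeries_succ hx0 hx

/-! ### Values at 0 and at π/2 -/

lemma exp_half_pi_even (m : ℤ) :
    Complex.exp (Complex.I * ((2 * m + 0 : ℤ) : ℂ) * ((Real.pi / 2 : ℝ) : ℂ)) = (-1) ^ m := by
  rw [← Complex.exp_pi_mul_I, ← Complex.exp_int_mul]
  congr 1
  push_cast
  ring

lemma exp_half_pi_odd (m : ℤ) :
    Complex.exp (Complex.I * ((2 * m + 1 : ℤ) : ℂ) * ((Real.pi / 2 : ℝ) : ℂ)) =
      Complex.I * (-1) ^ m := by
  have h := Complex.exp_pi_div_two_mul_I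
  rw [← exp_half_pi_even]
  nth_rw 2 [← h]
  rw [← Complex.exp_add]
  congr 1
  push_cast
  ring

lemma neg_one_zpow_neg (m : ℤ) : (-1 : ℂ) ^ (-m) = (-1) ^ m := by
  rw [zpow_neg, ← inv_zpow]
  norm_num

lemma neg_one_zpow_reflect (m : ℤ) : (-1 : ℂ) ^ (-1 - m) = -(-1) ^ m := by
  rw [zpow_sub₀ (by norm_num), ← neg_one_zpow_neg m, zpow_neg]
  norm_num
  rw [← zpow_neg, neg_one_zpow_neg]

lemma lam_even {x : ℂ} (m : ℤ) :
    lam (-1) x (2 * m + 0) = (x ^ 2) ^ m / (1 + (x ^ 2) ^ (2 * m)) := by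
  rw [lam, ← zpow_natCast x 2, ← zpow_mul, ← zpow_mul]
  push_cast
  ring_nf

lemma lam_odd {σ x : ℂ} (hx0 : x ≠ 0) (m : ℤ) :
    lam σ x (2 * m + 1) = x * ((x ^ 2) ^ m / (1 - σ * (x ^ 2) ^ (2 * m + 1))) := by
  rw [lam, zpow_add_one₀ hx0, ← zpow_natCast x 2, ← zpow_mul, ← zpow_mul]
  push_cast
  ring_nf

lemma oddMinus_neg (y : ℂ) : oddMinus (-y) = oddPlus y := by
  refine tprod_congr fun i => ?_
  rw [Odd.neg_pow ⟨i, rfl⟩]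
  ring

lemma oddPlus_neg (y : ℂ) : oddPlus (-y) = oddMinus y := by
  rw [← oddMinus_neg, neg_neg]

lemma evenMinus_neg (y : ℂ) : evenMinus (-y) = evenMinus y := by
  refine tprod_congr fun i => ?_
  rw [Even.neg_pow ⟨i + 1, by ring⟩]

lemma evenPlus_neg (y : ℂ) : evenPlus (-y) = evenPlus y := by
  refine tprod_congr fun i => ?_
  rw [Even.neg_pow ⟨i + 1, by ring⟩]

lemma dnSeries_zero {x : ℂ} (hx0 : x ≠ 0) (hx : ‖x‖ < 1) :
    dnSeries x 0 0 = (oddPlus (x ^ 2) * evenMinus (x ^ 2) /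
      (evenPlus (x ^ 2) * oddMinus (x ^ 2))) ^ 2 := by
  rw [← tsum_even_eq (pow_ne_zero 2 hx0) (norm_sq_lt_one hx), dnSeries, lamSeries]
  congr 1
  refine tsum_congr fun m => ?_
  rw [lam_even]
  simp

/-- At π/2 the exponentials become signs (-1)^m, absorbed by replacing x² with -x², which exchanges
`oddMinus` and `oddPlus`. -/
lemma dnSeries_half_pi {x : ℂ} (hx0 : x ≠ 0) (hx : ‖x‖ < 1) :
    dnSeries x 0 (Real.pi / 2) = (oddMinus (x ^ 2) * evenMinus (x ^ 2) /
      (evenPlus (x ^ 2) * oddPlus (x ^ 2))) ^ 2 := by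
  have h := tsum_even_eq (y := -x ^ 2) (neg_ne_zero.mpr (pow_ne_zero 2 hx0))
    (by rw [norm_neg]; exact norm_sq_lt_one hx)
  rw [oddMinus_neg, oddPlus_neg, evenMinus_neg, evenPlus_neg] at h
  rw [← h, dnSeries, lamSeries]
  congr 1
  refine tsum_congr fun m => ?_
  rw [lam_even, exp_half_pi_even, pow_zero, one_mul, zpow_mul (-x ^ 2), zpow_ofNat, neg_sq,
    ← neg_one_mul (x ^ 2), mul_zpow, zpow_mul (x ^ 2), zpow_ofNat]
  ring

lemma cnSeries_zero {x : ℂ} (hx0 : x ≠ 0) (hx : ‖x‖ < 1) :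
    cnSeries x 0 0 = 4 * x * (evenPlus (x ^ 2) * evenMinus (x ^ 2) /
      (oddPlus (x ^ 2) * oddMinus (x ^ 2))) ^ 2 := by
  have h := tsum_odd_eq (pow_ne_zero 2 hx0) (norm_sq_lt_one hx)
  have e : cnSeries x 0 0 = 2 * (x * ∑' j : ℤ, (x ^ 2) ^ j / (1 + (x ^ 2) ^ (2 * j + 1))) := by
    rw [cnSeries, lamSeries, ← tsum_mul_left, ← tsum_mul_left, ← tsum_mul_left]
    refine tsum_congr fun m => ?_
    rw [lam_odd hx0]
    simp
  rw [e, h]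
  ring

lemma snSeries_half_pi {x : ℂ} (hx0 : x ≠ 0) (hx : ‖x‖ < 1) :
    snSeries x (Real.pi / 2) = 4 * x * (evenPlus (x ^ 2) * evenMinus (x ^ 2) /
      (oddPlus (x ^ 2) * oddMinus (x ^ 2))) ^ 2 := by
  have hq0 := pow_ne_zero 2 hx0
  have h := tsum_odd_eq (y := -x ^ 2) (neg_ne_zero.mpr hq0)
    (by rw [norm_neg]; exact norm_sq_lt_one hx)
  rw [oddMinus_neg, oddPlus_neg, evenMinus_neg, evenPlus_neg] at h
  have e : snSeries x (Real.pi / 2) =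
      2 * (x * ∑' j : ℤ, (-x ^ 2) ^ j / (1 + (-x ^ 2) ^ (2 * j + 1))) := by
    rw [snSeries, lamSeries, ← tsum_mul_left, ← tsum_mul_left, ← tsum_mul_left]
    refine tsum_congr fun m => ?_
    rw [lam_odd hx0, exp_half_pi_odd, pow_zero, one_mul, zpow_add_one₀ (neg_ne_zero.mpr hq0),
      zpow_mul (-x ^ 2), zpow_ofNat, neg_sq, ← neg_one_mul (x ^ 2), mul_zpow,
      zpow_add_one₀ hq0, zpow_mul (x ^ 2), zpow_ofNat]
    rw [show 1 - 1 * (((x ^ 2) ^ 2) ^ m * x ^ 2) = 1 + ((x ^ 2) ^ 2) ^ m * (-1 * x ^ 2) by ring]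
    linear_combination (-2 * x * ((-1) ^ m * (x ^ 2) ^ m / (1 + ((x ^ 2) ^ 2) ^ m * (-1 * x ^ 2)))) *
      Complex.I_sq
  rw [e, h]
  ring

lemma tsum_eq_zero_of_reflect {f : ℤ → ℂ} (hf : ∀ m, f (-1 - m) = -f m) : ∑' m, f m = 0 := by
  have h := (Equiv.subLeft (-1 : ℤ)).tsum_eq f
  simp only [Equiv.subLeft_apply, hf, tsum_neg] at h
  linear_combination -h / 2

lemma lam_reflect {σ x : ℂ} (hσ : σ ^ 2 = 1) (hx0 : x ≠ 0) (m : ℤ) :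
    lam σ x (2 * (-1 - m) + 1) = -σ * lam σ x (2 * m + 1) := by
  rw [← lam_neg hσ hx0]
  congr 1
  ring

lemma snSeries_zero {x : ℂ} (hx0 : x ≠ 0) : snSeries x 0 = 0 := by
  rw [snSeries, lamSeries, tsum_eq_zero_of_reflect, mul_zero]
  intro m
  rw [lam_reflect (by norm_num) hx0]
  simp

lemma cnSeries_half_pi {x : ℂ} (hx0 : x ≠ 0) : cnSeries x 0 (Real.pi / 2) = 0 := by
  rw [cnSeries, lamSeries, tsum_eq_zero_of_reflect, mul_zero]
  intro m
  rw [lam_reflect (by norm_num) hx0, exp_half_pi_odd, exp_half_pi_odd, neg_one_zpow_reflect]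
  ring

lemma tsum_int_of_reflect {f : ℤ → ℂ} (hs : Summable f) (hf : ∀ m, f (-1 - m) = f m) :
    ∑' m, f m = 2 * ∑' n : ℕ, f n := by
  have h1 : Summable fun n : ℕ => f n := hs.comp_injective Nat.cast_injective
  have e : ∀ n : ℕ, f (-((n : ℤ) + 1)) = f n := fun n => by
    rw [← hf]
    congr 1
    ring
  rw [tsum_of_nat_of_neg_add_one h1 (by simpa only [e] using h1)]
  simp only [e]
  ring

/-! ### Eisenstein series as derivatives at the nome q^(1/2) -/

variable (τ : ℍ)

lemma qHalf_ne_zero : qHalf τ ≠ 0 := Complex.exp_ne_zero _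

lemma qHalf_sq : qHalf τ ^ 2 = q τ := by
  rw [qHalf, q, ← Complex.exp_nat_mul]
  congr 1
  push_cast
  ring

lemma norm_qHalf_lt_one : ‖qHalf τ‖ < 1 := by
  have h : ‖q τ‖ < 1 := UpperHalfPlane.norm_exp_two_pi_I_lt_one τ
  rw [← qHalf_sq, norm_pow] at h
  exact (pow_lt_one_iff_of_nonneg (norm_nonneg _) two_ne_zero).mp h

lemma norm_q_lt_one : ‖q τ‖ < 1 := UpperHalfPlane.norm_exp_two_pi_I_lt_one τ

/-- The terms at frequencies 2n + 1 and -(2n + 1) agree, so the constant 4 is this doubling times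
the 2 in `cnSeries`; the sign is I^(2m). -/
lemma cnSeries_even (m : ℕ) :
    cnSeries (qHalf τ) (2 * m) 0 = 4 * (-1) ^ m * Eis (2 * m + 1) τ := by
  have hx0 := qHalf_ne_zero τ
  have hs := (summable_lamSeries (σ := -1) (by norm_num) hx0 (norm_qHalf_lt_one τ) 1 (2 * m) 0).of_norm
  rw [cnSeries, lamSeries, tsum_int_of_reflect hs, Eis, ← tsum_mul_left, ← tsum_mul_left,
    ← tsum_mul_left, ← tsum_mul_left]
  · refine tsum_congr fun n => ?_
    rw [lam_odd hx0, qHalf_sq, mul_pow, pow_mul, Complex.I_sq, Nat.add_sub_cancel,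
      pow_mul (-1 : ℂ) 2, neg_one_sq, one_pow, one_mul]
    rw [show (2 * (n : ℤ) + 1) = ((2 * n + 1 : ℕ) : ℤ) by push_cast; rfl, zpow_natCast,
      zpow_natCast, Int.cast_natCast]
    simp
    ring
  · intro n
    rw [lam_reflect (by norm_num) hx0, show (2 * (-1 - n) + 1 : ℤ) = -(2 * n + 1) by ring]
    simp only [Complex.ofReal_zero, mul_zero, Int.cast_neg, mul_neg, pow_mul, neg_sq]
    ring

/-- Evaluation at π/2 supplies the alternating sign of `Eis` for even weight and a further factor I,
which turns I^(2m+1) into (-1)^(m+1). -/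
lemma cnSeries_odd (m : ℕ) :
    cnSeries (qHalf τ) (2 * m + 1) (Real.pi / 2) = 4 * (-1) ^ (m + 1) * Eis (2 * m + 2) τ := by
  have hx0 := qHalf_ne_zero τ
  have hs := (summable_lamSeries (σ := -1) (by norm_num) hx0 (norm_qHalf_lt_one τ) 1 (2 * m + 1)
    (Real.pi / 2)).of_norm
  rw [cnSeries, lamSeries, tsum_int_of_reflect hs, Eis, ← tsum_mul_left, ← tsum_mul_left,
    ← tsum_mul_left, ← tsum_mul_left]
  · refine tsum_congr fun n => ?_
    rw [lam_odd hx0, qHalf_sq, exp_half_pi_odd, mul_pow, show 2 * m + 2 - 1 = 2 * m + 1 by omega,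
      pow_succ Complex.I, pow_mul Complex.I, Complex.I_sq, pow_succ (-1 : ℂ) (2 * m),
      pow_mul (-1 : ℂ) 2, neg_one_sq, one_pow, one_mul]
    rw [show (2 * (n : ℤ) + 1) = ((2 * n + 1 : ℕ) : ℤ) by push_cast; rfl, zpow_natCast,
      zpow_natCast, zpow_natCast, Int.cast_natCast, mul_pow (-1 : ℂ) (q τ)]
    rw [show (1 : ℂ) - -1 * q τ ^ (2 * n + 1) = 1 + q τ ^ (2 * n + 1) by ring, pow_succ (-1 : ℂ) m]
    linear_combination (4 * (-1) ^ m * ((2 * n + 1 : ℕ) : ℂ) ^ (2 * m + 1) *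
      (qHalf τ * (q τ ^ n / (1 + q τ ^ (2 * n + 1)))) * (-1) ^ n) * Complex.I_sq
  · intro n
    rw [lam_reflect (by norm_num) hx0, exp_half_pi_odd, exp_half_pi_odd, neg_one_zpow_reflect,
      show (2 * (-1 - n) + 1 : ℤ) = -(2 * n + 1) by ring]
    rw [Int.cast_neg, mul_neg, Odd.neg_pow ⟨m, rfl⟩]
    ring

/-- The frequencies are 2n, so (2nI)^(2m) yields (-4)^m. For m ≠ 0 differentiation kills the
constant Fourier term, which `EisTilde` lacks. -/
lemma dnSeries_even {m : ℕ} (hm : m ≠ 0) :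
    dnSeries (qHalf τ) (2 * m) (Real.pi / 2) = 4 * (-4) ^ m * EisTilde (2 * m + 1) τ := by
  have hx0 := qHalf_ne_zero τ
  have hs := (summable_lamSeries (σ := -1) (by norm_num) hx0 (norm_qHalf_lt_one τ) 0 (2 * m)
    (Real.pi / 2)).of_norm
  rw [dnSeries, lamSeries, tsum_int_eq_zero_add_two_mul_tsum_pnat _ hs, EisTilde, nsmul_eq_mul,
    ← tsum_mul_left, ← tsum_mul_left]
  · have h0 : (Complex.I * ((2 * 0 + 0 : ℤ) : ℂ)) ^ (2 * m) = 0 := by simp [hm]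
    rw [h0, zero_mul, zero_mul, zero_add, ← tsum_mul_left]
    refine tsum_congr fun n => ?_
    rw [lam_even, qHalf_sq, exp_half_pi_even, Nat.add_sub_cancel, add_zero, mul_pow, pow_mul,
      Complex.I_sq, zpow_natCast, zpow_natCast,
      show (2 * ((n : ℕ) : ℤ)) = ((2 * n : ℕ) : ℤ) by push_cast; rfl, zpow_natCast,
      Int.cast_natCast, neg_pow (q τ), Nat.cast_mul, mul_pow, pow_mul ((2 : ℕ) : ℂ)]
    rw [show (-4 : ℂ) = (-1) * ((2 : ℕ) : ℂ) ^ 2 by norm_num, mul_pow]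
    push_cast
    ring
  · intro n
    simp only [exp_half_pi_even, neg_one_zpow_neg]
    rw [show 2 * -n + 0 = -(2 * n + 0) by ring, lam_neg (by norm_num) hx0, Int.cast_neg, mul_neg,
      pow_mul, neg_sq, ← pow_mul]
    ring

/-! ### Euler products and eta quotients -/

/-- Euler's product `∏ (1 - y^(n+1))`. -/
def eulerProd (y : ℂ) : ℂ := ∏' n : ℕ, (1 - y ^ (n + 1))

lemma eulerProd_eq {y : ℂ} (hy : ‖y‖ < 1) : eulerProd y = oddMinus y * evenMinus y := by
  have h1 := multipliable_one_add_mul hy (-1) 1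
  have h2 := multipliable_one_add_mul hy (-1) 2
  have := tprod_even_mul_odd (f := fun n : ℕ => 1 + -1 * y ^ (n + 1)) h1 (by simpa using h2)
  rw [eulerProd, oddMinus, evenMinus]
  simpa [sub_eq_add_neg, add_assoc] using this.symm

lemma eulerProd_sq (y : ℂ) : eulerProd (y ^ 2) = evenMinus y := by
  refine tprod_congr fun n => ?_
  rw [← pow_mul]
  ring

lemma evenMinus_sq {y : ℂ} (hy : ‖y‖ < 1) : evenMinus (y ^ 2) = evenMinus y * evenPlus y := by
  rw [evenMinus, evenMinus, evenPlus, ← (multipliable_one_add_mul hy (-1) 2).tprod_mul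
    (multipliable_one_add_mul hy 1 2)]
  refine tprod_congr fun n => ?_
  ring

lemma oddMinus_sq {y : ℂ} (hy : ‖y‖ < 1) : oddMinus (y ^ 2) = oddMinus y * oddPlus y := by
  rw [oddMinus, oddMinus, oddPlus, ← (multipliable_one_add_mul hy (-1) 1).tprod_mul
    (multipliable_one_add_mul hy 1 1)]
  refine tprod_congr fun n => ?_
  ring

/-- Split the Euler product at y² into odd and even exponents, factor each part by 1 - y^(2n) = (1 -
y^n)(1 + y^n), and cancel `evenMinus y`. -/
lemma oddMinus_mul_oddPlus_mul_evenPlus {y : ℂ} (hy : ‖y‖ < 1) :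
    oddMinus y * oddPlus y * evenPlus y = 1 := by
  have h := eulerProd_eq (norm_sq_lt_one hy)
  rw [eulerProd_sq, evenMinus_sq hy, oddMinus_sq hy] at h
  apply mul_left_cancel₀ (evenMinus_ne_zero hy)
  linear_combination -h

/-- The root `q^(1/24)`. -/
def qRoot : ℂ := Complex.exp (2 * Real.pi * Complex.I * (τ : ℂ) / 24)

lemma qRoot_ne_zero : qRoot τ ≠ 0 := Complex.exp_ne_zero _

lemma qRoot_pow : qRoot τ ^ 12 = qHalf τ := by
  rw [qHalf, qRoot, ← Complex.exp_nat_mul]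
  congr 1
  push_cast
  ring

lemma etaAt_eq (d : ℕ) : etaAt d τ = qRoot τ ^ d * eulerProd (q τ ^ d) := by
  rw [etaAt, ModularForm.eta, qRoot, ← Complex.exp_nat_mul, eulerProd]
  congr 1
  · rw [Function.Periodic.qParam]
    congr 1
    push_cast
    ring
  · refine tprod_congr fun n => ?_
    rw [ModularForm.eta_q_eq_pow, q, ← Complex.exp_nat_mul _ d]
    congr 3
    ring

lemma etaAt_one : etaAt 1 τ = qRoot τ * (oddMinus (q τ) * evenMinus (q τ)) := by
  rw [etaAt_eq, pow_one, pow_one, eulerProd_eq (norm_q_lt_one τ)]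

lemma etaAt_two : etaAt 2 τ = qRoot τ ^ 2 * evenMinus (q τ) := by
  rw [etaAt_eq, eulerProd_sq]

lemma etaAt_four : etaAt 4 τ = qRoot τ ^ 4 * (evenMinus (q τ) * evenPlus (q τ)) := by
  rw [etaAt_eq, show q τ ^ 4 = (q τ ^ 2) ^ 2 by ring, eulerProd_sq, evenMinus_sq (norm_q_lt_one τ)]

lemma F_ne_zero : F τ ≠ 0 := by
  have hq := norm_q_lt_one τ
  have h1 := oddMinus_ne_zero hq
  have h2 := evenMinus_ne_zero hq
  have h3 := evenPlus_ne_zero hq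
  have h4 := qRoot_ne_zero τ
  rw [F, etaAt_one, etaAt_two, etaAt_four]
  positivity

lemma z_ne_zero : z τ ≠ 0 := by
  have hq := norm_q_lt_one τ
  have h1 := oddMinus_ne_zero hq
  have h2 := evenMinus_ne_zero hq
  have h3 := evenPlus_ne_zero hq
  have h4 := qRoot_ne_zero τ
  rw [z, etaAt_one, etaAt_two, etaAt_four]
  simp [h1, h2, h3, h4]

lemma zTilde_ne_zero : zTilde τ ≠ 0 := by
  have hq := norm_q_lt_one τ
  have h1 := oddMinus_ne_zero hq
  have h2 := evenMinus_ne_zero hq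
  have h3 := evenPlus_ne_zero hq
  have h4 := qRoot_ne_zero τ
  rw [zTilde, etaAt_one, etaAt_two, etaAt_four]
  positivity

/-- Eliminating `oddPlus` leaves the three products that occur in the eta quotients, so the
identities below become purely algebraic. -/
lemma oddPlus_eq : oddPlus (q τ) = 1 / (oddMinus (q τ) * evenPlus (q τ)) := by
  have hq := norm_q_lt_one τ
  have h := oddMinus_mul_oddPlus_mul_evenPlus hq
  rw [eq_div_iff (mul_ne_zero (oddMinus_ne_zero hq) (evenPlus_ne_zero hq))]
  linear_combination h

lemma dnSeries_zero_eq : dnSeries (qHalf τ) 0 0 = F τ := by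
  have hq := norm_q_lt_one τ
  have h1 := oddMinus_ne_zero hq
  have h2 := evenMinus_ne_zero hq
  have h3 := evenPlus_ne_zero hq
  have h4 := qRoot_ne_zero τ
  rw [dnSeries_zero (qHalf_ne_zero τ) (norm_qHalf_lt_one τ), qHalf_sq, oddPlus_eq, F, etaAt_one,
    etaAt_two, etaAt_four]
  field_simp

lemma dnSeries_half_pi_eq : dnSeries (qHalf τ) 0 (Real.pi / 2) = F τ * zTilde τ := by
  have hq := norm_q_lt_one τ
  have h1 := oddMinus_ne_zero hq
  have h2 := evenMinus_ne_zero hq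
  have h3 := evenPlus_ne_zero hq
  have h4 := qRoot_ne_zero τ
  rw [dnSeries_half_pi (qHalf_ne_zero τ) (norm_qHalf_lt_one τ), qHalf_sq, oddPlus_eq, F, zTilde,
    etaAt_one, etaAt_two, etaAt_four]
  field_simp

lemma theta_two_sq_eq : 4 * qHalf τ * (evenPlus (q τ) * evenMinus (q τ) /
    (oddPlus (q τ) * oddMinus (q τ))) ^ 2 = F τ * z τ := by
  have hq := norm_q_lt_one τ
  have h1 := oddMinus_ne_zero hq
  have h2 := evenMinus_ne_zero hq
  have h3 := evenPlus_ne_zero hq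
  have h4 := qRoot_ne_zero τ
  rw [oddPlus_eq, F, z, etaAt_one, etaAt_two, etaAt_four, ← qRoot_pow]
  field_simp

lemma cnSeries_zero_eq : cnSeries (qHalf τ) 0 0 = F τ * z τ := by
  rw [cnSeries_zero (qHalf_ne_zero τ) (norm_qHalf_lt_one τ), qHalf_sq, theta_two_sq_eq]

lemma snSeries_half_pi_eq : snSeries (qHalf τ) (Real.pi / 2) = F τ * z τ := by
  rw [snSeries_half_pi (qHalf_ne_zero τ) (norm_qHalf_lt_one τ), qHalf_sq, theta_two_sq_eq]

/-! ### The polynomials for each parity of the weight -/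

lemma jacobiSystem_qHalf :
    JacobiSystem (snSeries (qHalf τ)) (cnSeries (qHalf τ)) (dnSeries (qHalf τ)) :=
  jacobiSystem (qHalf_ne_zero τ) (norm_qHalf_lt_one τ)

/-- The first integral d² - c² equals F² - F²z² at 0 and F²z̃² at π/2. -/
lemma zTilde_sq : zTilde τ ^ 2 = 1 - z τ ^ 2 := by
  have h := (jacobiSystem_qHalf τ).sq_sub_sq 0 (Real.pi / 2)
  rw [dnSeries_zero_eq, cnSeries_zero_eq, dnSeries_half_pi_eq,
    cnSeries_half_pi (qHalf_ne_zero τ)] at h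
  apply mul_left_cancel₀ (pow_ne_zero 2 (F_ne_zero τ))
  linear_combination -h

lemma exists_poly_Eis_odd (m : ℕ) : ∃ P : Polynomial ℤ, P.natDegree ≤ m ∧ ∀ τ : ℍ,
    Eis (2 * m + 1) τ = 1 / 4 * F τ ^ (2 * m + 1) * z τ * Polynomial.aeval (z τ ^ 2) P := by
  obtain ⟨p, hp, h⟩ := JacobiSystem.exists_poly_c_even m
  refine ⟨(-1) ^ m * p, ?_, fun τ => ?_⟩
  · rcases neg_one_pow_eq_or (Polynomial ℤ) m with e | e <;> simpa [e] using hp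
  · have h1 := h _ _ _ (jacobiSystem_qHalf τ) 0 (F τ) (z τ) (snSeries_zero (qHalf_ne_zero τ))
      (cnSeries_zero_eq τ) (dnSeries_zero_eq τ)
    rw [cnSeries_even] at h1
    have h2 : ((-1 : ℂ) ^ m) * (-1) ^ m = 1 := by rw [← mul_pow]; norm_num
    simp only [map_mul, map_pow, map_neg, map_one]
    linear_combination (1 / 4 * (-1) ^ m) * h1 - Eis (2 * m + 1) τ * h2

lemma exists_poly_Eis_even (m : ℕ) : ∃ P : Polynomial ℤ, P.natDegree ≤ m ∧ ∀ τ : ℍ,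
    Eis (2 * m + 2) τ =
      1 / 4 * F τ ^ (2 * m + 2) * z τ * zTilde τ * Polynomial.aeval (z τ ^ 2) P := by
  obtain ⟨p, hp, h⟩ := JacobiSystem.exists_poly_c_odd m
  refine ⟨(-1) ^ (m + 1) * p, ?_, fun τ => ?_⟩
  · rcases neg_one_pow_eq_or (Polynomial ℤ) (m + 1) with e | e <;> simpa [e] using hp
  · have h1 := h _ _ _ (jacobiSystem_qHalf τ) (Real.pi / 2) (F τ) (z τ) (zTilde τ)
      (cnSeries_half_pi (qHalf_ne_zero τ)) (snSeries_half_pi_eq τ) (dnSeries_half_pi_eq τ)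
      (zTilde_sq τ)
    rw [cnSeries_odd] at h1
    have h2 : ((-1 : ℂ) ^ (m + 1)) * (-1) ^ (m + 1) = 1 := by rw [← mul_pow]; norm_num
    simp only [map_mul, map_pow, map_neg, map_one]
    linear_combination (1 / 4 * (-1) ^ (m + 1)) * h1 - Eis (2 * m + 2) τ * h2

lemma exists_poly_EisTilde {m : ℕ} (hm : m ≠ 0) : ∃ Q : Polynomial ℚ, Q.natDegree ≤ m ∧
    Q.eval 0 = 0 ∧ ∀ τ : ℍ, EisTilde (2 * m + 1) τ =
      1 / 4 * F τ ^ (2 * m + 1) * zTilde τ * Polynomial.aeval (z τ ^ 2) Q := by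
  obtain ⟨p, hp, hp0, h⟩ := JacobiSystem.exists_poly_d_even m
  -- Removing the factor (-4)^m from `dnSeries_even` is what forces rational coefficients.
  refine ⟨Polynomial.C ((-4) ^ m)⁻¹ * p.map (Int.castRingHom ℚ), ?_, ?_, fun τ => ?_⟩
  · exact (Polynomial.natDegree_C_mul_le _ _).trans (Polynomial.natDegree_map_le.trans hp)
  · have := Polynomial.eval_intCast_map (Int.castRingHom ℚ) p 0
    rw [Int.cast_zero, Int.cast_zero, hp0 hm, map_zero] at this
    rw [Polynomial.eval_mul, this, mul_zero]
  · have h1 := h _ _ _ (jacobiSystem_qHalf τ) (Real.pi / 2) (F τ) (z τ) (zTilde τ)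
      (cnSeries_half_pi (qHalf_ne_zero τ)) (snSeries_half_pi_eq τ) (dnSeries_half_pi_eq τ)
      (zTilde_sq τ)
    rw [dnSeries_even τ hm] at h1
    have h2 : ((-4 : ℂ) ^ m) ≠ 0 := pow_ne_zero _ (by norm_num)
    have h3 : Polynomial.aeval (z τ ^ 2) (p.map (Int.castRingHom ℚ)) =
        Polynomial.aeval (z τ ^ 2) p := Polynomial.aeval_map_algebraMap ℚ (z τ ^ 2) p
    rw [map_mul, h3, Polynomial.aeval_C]
    simp only [map_inv₀, map_pow, map_neg, map_ofNat]
    field_simp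
    linear_combination h1

end EisPoly

end
-- The equivalences encode well-definedness: the relation constrains a function only on `zSqValues`,
-- and there it holds exactly when the function agrees with the polynomial. The degree found is in
-- fact at most (k - 1)/2.
theorem mainTheorem8 (k : ℕ) (hk : 1 < k) :
    (∃ P : Polynomial ℤ, P.natDegree ≤ k ∧
      ∀ μ : ℂ → ℂ, EisPoly.IsMu k μ ↔
        Set.EqOn μ (fun x => Polynomial.aeval x P) EisPoly.zSqValues) ∧
    (Odd k → ∃ Q : Polynomial ℚ, Q.natDegree ≤ k ∧ Q.eval 0 = 0 ∧
      ∀ ν : ℂ → ℂ, EisPoly.IsNu k ν ↔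
        Set.EqOn ν (fun x => Polynomial.aeval x Q) EisPoly.zSqValues) := by
  have hF := fun τ => pow_ne_zero k (EisPoly.F_ne_zero τ)
  have hz := EisPoly.z_ne_zero
  have hz' := EisPoly.zTilde_ne_zero
  refine ⟨?_, fun hodd => ?_⟩
  · rcases Nat.even_or_odd k with heven | hodd
    · obtain ⟨m, rfl⟩ : ∃ m, k = 2 * m + 2 := by
        obtain ⟨r, hr⟩ := heven
        exact ⟨r - 1, by omega⟩
      obtain ⟨P, hP, h⟩ := EisPoly.exists_poly_Eis_even m
      refine ⟨P, by omega, fun μ => ⟨fun hμ => ?_, fun hμ => ⟨fun _ τ => ?_, fun ho => ?_⟩⟩⟩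
      · rintro _ ⟨τ, rfl⟩
        refine mul_left_cancel₀ ?_ ((hμ.1 heven τ).symm.trans (h τ))
        exact mul_ne_zero (mul_ne_zero (mul_ne_zero (by norm_num) (hF τ)) (hz τ)) (hz' τ)
      · rw [hμ ⟨τ, rfl⟩, h τ]
      · exact absurd heven (Nat.not_even_iff_odd.mpr ho)
    · obtain ⟨m, rfl⟩ := id hodd
      obtain ⟨P, hP, h⟩ := EisPoly.exists_poly_Eis_odd m
      refine ⟨P, by omega, fun μ => ⟨fun hμ => ?_, fun hμ => ⟨fun he => ?_, fun _ τ => ?_⟩⟩⟩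
      · rintro _ ⟨τ, rfl⟩
        refine mul_left_cancel₀ ?_ ((hμ.2 hodd τ).symm.trans (h τ))
        exact mul_ne_zero (mul_ne_zero (by norm_num) (hF τ)) (hz τ)
      · exact absurd he (Nat.not_even_iff_odd.mpr hodd)
      · rw [hμ ⟨τ, rfl⟩, h τ]
  · obtain ⟨m, rfl⟩ := hodd
    obtain ⟨Q, hQ, hQ0, h⟩ := EisPoly.exists_poly_EisTilde (m := m) (by omega)
    refine ⟨Q, by omega, hQ0, fun ν => ⟨fun hν => ?_, fun hν τ => ?_⟩⟩
    · rintro _ ⟨τ, rfl⟩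
      refine mul_left_cancel₀ ?_ ((hν τ).symm.trans (h τ))
      exact mul_ne_zero (mul_ne_zero (by norm_num) (hF τ)) (hz' τ)
    · rw [hν ⟨τ, rfl⟩, h τ]
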